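/- Let $\mathfrak b$ be the Lie algebra of upper triangular real $3\times 3$ matrices of trace zero, $\mathfrak a\subset\mathfrak b$ the subspace of diagonal matrices, and $B_0\subset \mathrm{SL}_3(\mathbb R)$ the group of upper triangular matrices with positive diagonal, acting on $\mathfrak b$ by the adjoint action $\mathrm{Ad}\,g(X)=gXg^{-1}$. Let $Y$ be the space of all $2$-dimensional abelian Lie subalgebras of $\mathfrak b$, with the Chabauty topology (as closed subgroups of $\mathfrak{sl}_3(\mathbb R)$). For $[x:y]\in\mathbb P^1(\mathbb R)$ put $$\mathfrak l_{[x:y]}=\left\{\begin{pmatrix}0&tx&s\\0&0&ty\\0&0&0\end{pmatrix}: s,t\in\mathbb R\right\}\in Y,$$ and identify $\mathbb P^1(\mathbb R)$ with the circle $\{\mathfrak l_{[x:y]}\}\subset Y$. Let $\alpha(H)=H_{11}-H_{22}$ and $\beta(H)=H_{22}-H_{33}$ on $\mathfrak a$ and, for $\gamma\in\{\alpha,\beta,\alpha+\beta\}$, let $\mathfrak l_\gamma=\ker\gamma\oplus\mathfrak n^\gamma\in Y$, where $\mathfrak n^\alpha=\mathbb RE_{12}$, $\mathfrak n^\beta=\mathbb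 RE_{23}$, $\mathfrak n^{\alpha+\beta}=\mathbb RE_{13}$. The cells of the CW complex $Y$ are the $B_0$-orbits: two $0$-cells, the orbits of $\mathfrak l_{[1:0]}$ and $\mathfrak l_{[0:1]}$; two $1$-cells, the orbits of $\mathfrak l_{[1:1]}$ and $\mathfrak l_{[1:-1]}$; three $2$-cells, the orbits of $\mathfrak l_\alpha$, $\mathfrak l_\beta$ and $\mathfrak l_{\alpha+\beta}$; one $3$-cell, the orbit of $\mathfrak a$. Let $Y^{(2)}\subset Y$ be the $2$-skeleton, i.e. the union of the cells of dimension at most $2$. **Proposition 5.11.** The $2$-skeleton $Y^{(2)}$ has the homotopy type of the wedge $\mathbb S^2\vee\mathbb S^2\vee\mathbb P^2(\mathbb R)$ of two $2$-spheres and a real projective plane. Moreover $Y$ is path connected, $\pi_1(Y)\cong\mathbb Z/2\mathbb Z$ at every base point, and $\pi_1(Y)$ is generated by the homotopy class of a loop traversing the circle $\mathbb P^1(\mathbb R)$ once: such loops exist at every base point in $\mathbb P^1(\mathbb R)$, and the class of each of them generates. (A loop traverses the circle once if its image is the circle and it passes through no point twice, except that its two ends agree.) -/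

import Mathlib

open scoped ContinuousMap

noncomputable section

/-! ### The Chabauty topology on the space of closed subgroups -/

/-- The Chabauty topology on the closed subgroups of a (locally compact) additive group `E`: it is
generated by the sets of subgroups that miss a given compact set and the sets of subgroups that
meet a given open set. -/
@[reducible] def chabautyTopology (E : Type*) [AddGroup E] [TopologicalSpace E] :
    TopologicalSpace (ClosedAddSubgroup E) :=
  TopologicalSpace.generateFrom
    ({s | ∃ K : Set E, IsCompact K ∧ s = {H : ClosedAddSubgroup E | Disjoint (H : Set E) K}} ∪
      {s | ∃ U : Set E, IsOpen U ∧ s = {H : ClosedAddSubgroup E | ((H : Set E) ∩ U).Nonempty}})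

namespace SL3

/-! ### Subspaces of `𝔰𝔩₃(ℝ)` and the group `B₀`

As in Mathlib's definition of `𝔰𝔩₃(ℝ)`, everything is realised inside the space `M₃(ℝ)` of real
`3 × 3` matrices, with its usual topology and the bracket `⁅X, Y⁆ = X * Y - Y * X`. -/

attribute [local instance] LieRing.ofAssociativeRing

/-- The space of real `3 × 3` matrices, which contains `𝔤 = 𝔰𝔩₃(ℝ)`. -/
abbrev Mat : Type := Matrix (Fin 3) (Fin 3) ℝ

/-- The Borel subalgebra `𝔟`: the upper triangular matrices of trace zero. -/
def borel : LieSubalgebra ℝ Mat where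
  carrier := {X | X ∈ LieAlgebra.SpecialLinear.sl (Fin 3) ℝ ∧ X.BlockTriangular id}
  add_mem' hX hY := ⟨add_mem hX.1 hY.1, hX.2.add hY.2⟩
  zero_mem' := ⟨zero_mem _, Matrix.blockTriangular_zero⟩
  smul_mem' c X hX := ⟨Submodule.smul_mem _ c hX.1, fun i j hij => by simp [hX.2 hij]⟩
  lie_mem' {X Y} hX hY := by
    refine ⟨LieSubalgebra.lie_mem _ hX.1 hY.1, ?_⟩
    rw [Ring.lie_def]
    exact (hX.2.mul hY.2).sub (hY.2.mul hX.2)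

/-- The group `B₀ = AN`: the upper triangular matrices in `SL₃(ℝ)` with positive diagonal. -/
def B₀ : Set (Matrix.SpecialLinearGroup (Fin 3) ℝ) :=
  {g | (g : Mat).BlockTriangular id ∧ ∀ i, 0 < (g : Mat) i i}

/-- The adjoint action `Ad g : X ↦ g X g⁻¹`. -/
def Ad (g : Matrix.SpecialLinearGroup (Fin 3) ℝ) : Mat →ₗ[ℝ] Mat where
  toFun X := (g : Mat) * X * ((g⁻¹ : Matrix.SpecialLinearGroup (Fin 3) ℝ) : Mat)
  map_add' X Y := by rw [mul_add, add_mul]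
  map_smul' c X := by simp

/-- The Cartan subspace `𝔞`: the diagonal matrices of trace zero. -/
def cartan : Submodule ℝ Mat where
  carrier := {X | X.IsDiag ∧ X.trace = 0}
  add_mem' hX hY := ⟨hX.1.add hY.1, by rw [Matrix.trace_add, hX.2, hY.2, add_zero]⟩
  zero_mem' := ⟨Matrix.isDiag_zero, Matrix.trace_zero _ _⟩
  smul_mem' c X hX := ⟨hX.1.smul c, by rw [Matrix.trace_smul, hX.2, smul_zero]⟩

/-- The linear form `X ↦ Xᵢᵢ - Xⱼⱼ`. On `𝔞` the forms `root 0 1`, `root 1 2` and `root 0 2` are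
the positive roots `α`, `β` and `α + β`. -/
def root (i j : Fin 3) : Mat →ₗ[ℝ] ℝ where
  toFun X := X i i - X j j
  map_add' X Y := by simp only [Matrix.add_apply]; ring
  map_smul' c X := by simp only [Matrix.smul_apply, smul_eq_mul, RingHom.id_apply]; ring

/-- The plane `𝔩_γ = ker γ ⊕ 𝔫^γ`, for the root `γ = root i j` with root space `ℝ Eᵢⱼ`. -/
def rootPlane (i j : Fin 3) : Submodule ℝ Mat :=
  (cartan ⊓ LinearMap.ker (root i j)) ⊔ Submodule.span ℝ {Matrix.single i j (1 : ℝ)}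

/-- The plane `𝔩_{[x:y]}` of the matrices `!![0, t x, s; 0, 0, t y; 0, 0, 0]`, for
`(x, y) ≠ (0, 0)`. -/
def nilPlane (x y : ℝ) : Submodule ℝ Mat :=
  Submodule.span ℝ {!![0, x, 0; 0, 0, y; 0, 0, 0], !![0, 0, 1; 0, 0, 0; 0, 0, 0]}

/-! ### The space `Y` -/

/-- The space `Y` of two-dimensional abelian Lie subalgebras of `𝔟`; a linear subspace on which the
bracket vanishes is the same thing as an abelian Lie subalgebra. -/
def Y : Type :=
  {l : Submodule ℝ Mat // l ≤ borel.toSubmodule ∧ (∀ X ∈ l, ∀ Z ∈ l, ⁅X, Z⁆ = 0) ∧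
    Module.finrank ℝ l = 2}

/-- A subalgebra of `𝔟` as a closed subgroup of the vector space of matrices. -/
def Y.toClosedAddSubgroup (l : Y) : ClosedAddSubgroup Mat where
  toAddSubgroup := l.1.toAddSubgroup
  isClosed' := l.1.closed_of_finiteDimensional

/-- `Y` carries the topology induced by the Chabauty topology. (Since `𝔤` is closed in the space of
matrices, it does not matter whether closed subgroups of `𝔤` or of the space of matrices are
used.) -/
instance : TopologicalSpace Y :=
  TopologicalSpace.induced Y.toClosedAddSubgroup (chabautyTopology Mat)

/-- Representatives of the `B₀`-orbits in `Y`, by dimension of the orbit. The orbits are the open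
cells of `Y`: two 0-cells, two 1-cells, three 2-cells and one 3-cell. -/
def cellReps : ℕ → Set (Submodule ℝ Mat)
  | 0 => {nilPlane 1 0, nilPlane 0 1}
  | 1 => {nilPlane 1 1, nilPlane 1 (-1)}
  | 2 => {rootPlane 0 1, rootPlane 1 2, rootPlane 0 2}
  | 3 => {cartan}
  | _ => ∅

/-- The `n`-skeleton of `Y`: the union of the cells, i.e. of the `B₀`-orbits, of dimension at
most `n`. -/
def skeleton (n : ℕ) : Set Y :=
  {l | ∃ k ≤ n, ∃ l₀ ∈ cellReps k, ∃ g ∈ B₀, l.1 = l₀.map (Ad g)}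

/-- The circle `ℙ¹(ℝ)` in `Y`, consisting of the subalgebras `𝔩_{[x:y]}`. -/
def projLine : Set Y :=
  {l | ∃ x y : ℝ, (x, y) ≠ (0, 0) ∧ l.1 = nilPlane x y}

end SL3

/-! ### Loops running once around a circle, and the wedge of two spheres and a projective plane -/

/-- The loop `γ` traverses the circle `S` exactly once: it has image `S`, and passes through no
point twice, except that its two ends agree. -/
def TraversesOnce {X : Type*} [TopologicalSpace X] {p : X} (γ : Path p p) (S : Set X) : Prop :=
  Set.range γ = S ∧ Set.InjOn γ (Set.Iio 1)

/-- The wedge of two pointed spaces. -/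
def Wedge (X Z : Type) (x : X) (z : Z) : Type :=
  Quot fun a b : X ⊕ Z => a = Sum.inl x ∧ b = Sum.inr z

instance (X Z : Type) [TopologicalSpace X] [TopologicalSpace Z] (x : X) (z : Z) :
    TopologicalSpace (Wedge X Z x z) :=
  inferInstanceAs (TopologicalSpace (Quot _))

/-- The inclusion of the first space in the wedge. -/
def Wedge.inl {X Z : Type} (x : X) (z : Z) (a : X) : Wedge X Z x z :=
  Quot.mk _ (Sum.inl a)

/-- The sphere `𝕊²`. -/
abbrev Sphere2 : Type := Metric.sphere (0 : EuclideanSpace ℝ (Fin 3)) 1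

/-- The base point of `𝕊²`. -/
def Sphere2.base : Sphere2 := ⟨EuclideanSpace.single 2 1, by simp⟩

/-- The real projective plane: the lines in `ℝ³`, with the quotient topology from `ℝ³ ∖ {0}`. -/
def RealProjectivePlane : Type := Projectivization ℝ (Fin 3 → ℝ)

instance : TopologicalSpace RealProjectivePlane :=
  inferInstanceAs (TopologicalSpace (Quotient (projectivizationSetoid ℝ (Fin 3 → ℝ))))

/-- The base point of the real projective plane. -/
def RealProjectivePlane.base : RealProjectivePlane :=
  Projectivization.mk ℝ (Pi.single 2 1) (by simp)

/-- The wedge `𝕊² ∨ 𝕊² ∨ ℙ²(ℝ)`. -/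
abbrev SpheresWedgeProjectivePlane : Type :=
  Wedge (Wedge Sphere2 Sphere2 Sphere2.base Sphere2.base) RealProjectivePlane
    (Wedge.inl _ _ Sphere2.base) RealProjectivePlane.base

end

open Set Topology
open scoped ContinuousMap

/-! For a plane spanned by X and Z in 𝔟, the condition ⁅X, Z⁆ = 0 is linear in the 2 × 2 minors: it
cuts the ten minors down to seven. So Y is the projectivisation of the cone in ℝ⁷ given by the five
Plücker relations. The unit vectors of this cone form a compact space `UnitCone` that covers Y
twice, with deck group ±1 (`isQuotientCoveringMap_toY`).

Fundamental group. The cone without its vertex is simply connected. Indeed, it is covered by the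
open set where p 5 or p 6 is nonzero and by contractible charts, each meeting the union of the
previous sets in a path connected set; by the surjectivity half of van Kampen's theorem
(`pathsPushInto_union`) every loop can be pushed into the first set (`pathsPushInto_univ`). A
rescaled one-parameter group of diagonal matrices contracts that set onto the punctured plane over
ℙ¹(ℝ), and a loop there dies in a half-space whose extra direction is 𝔩_{α+β}. Hence π₁(Y) is the
deck group. The preimage of ℙ¹(ℝ) is a connected circle, so a loop running once around ℙ¹(ℝ) cannot
lift to a closed path, and its class is the nontrivial one.

The 2-skeleton. The coordinate p 0 is the minor of the diagonal parts, and B₀ does not change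
diagonals, so the 2-skeleton is p 0 = 0 (`toY_mem_skeleton`). There the locus p 1 = p 2 = 0 is a
projective plane, the planes containing E₁₃, while p 1 ≠ 0 and p 2 ≠ 0 are two disjoint open discs,
the cells of 𝔩_α and 𝔩_β. Their attaching maps lift to nonzero vectors of ℝ³ with last coordinate
zero, and a segment to (0, 0, 1) contracts them. Since homotopic attaching maps give homotopy
equivalent spaces (`IsConeAttachment.nonempty_homotopyEquiv`), both discs become spheres wedged to
the projective plane. -/

/-! ### Pushing paths into open subsets -/

/-- Every point of `W` can be joined to a point of `U`, and every path in `W` with ends in `U` is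
homotopic to a path in `U`. -/
structure PathsPushInto {X : Type*} [TopologicalSpace X] (U W : Set X) : Prop where
  points : ∀ x ∈ W, ∃ y ∈ U, Joined x y
  paths : ∀ ⦃a b : X⦄ (γ : Path a b), a ∈ U → b ∈ U → range γ ⊆ W →
    ∃ γ' : Path a b, range γ' ⊆ U ∧ γ.Homotopic γ'

/-- Any two paths in `V` with the same ends are homotopic in the ambient space. -/
def PathsHomotopicIn {X : Type*} [TopologicalSpace X] (V : Set X) : Prop :=
  ∀ ⦃a b : X⦄ (γ γ' : Path a b), range γ ⊆ V → range γ' ⊆ V → γ.Homotopic γ'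

theorem PathsPushInto.trans {X : Type*} [TopologicalSpace X] {U W T : Set X} (hUW : U ⊆ W)
    (h₁ : PathsPushInto U W) (h₂ : PathsPushInto W T) : PathsPushInto U T := by
  refine ⟨fun x hx => ?_, fun a b γ ha hb hγ => ?_⟩
  · obtain ⟨y, hy, hxy⟩ := h₂.points x hx
    obtain ⟨z, hz, hyz⟩ := h₁.points y hy
    exact ⟨z, hz, hxy.trans hyz⟩
  obtain ⟨γ₁, h, h'⟩ := h₂.paths γ (hUW ha) (hUW hb) hγ
  obtain ⟨γ₂, k, k'⟩ := h₁.paths γ₁ ha hb h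
  exact ⟨γ₂, k, h'.trans k'⟩

/-- The part of van Kampen's theorem that says that `π₁(U) → π₁(U ∪ V)` is surjective if `V` is
simply connected and `U ∩ V` is path connected. -/
theorem pathsPushInto_union {X : Type*} [TopologicalSpace X] {U V : Set X} (hU : IsOpen U)
    (hV : IsOpen V) (hVV : PathsHomotopicIn V) (hVU : ∀ x ∈ V, ∃ y ∈ U, Joined x y)
    (hUV : ∀ x ∈ U ∩ V, ∀ y ∈ U ∩ V, JoinedIn (U ∩ V) x y) : PathsPushInto U (U ∪ V) := by
  refine ⟨fun x hx => hx.elim (fun h => ⟨x, h, Joined.refl x⟩) (hVU x), fun a b γ ha hb hγ => ?_⟩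
  obtain ⟨t, t0, tm, ⟨m, hm⟩, ht⟩ := exists_monotone_Icc_subset_open_cover_unitInterval
    (c := fun i : Bool => γ ⁻¹' (if i then U else V))
    (by rintro (_ | _) <;> simp [hU.preimage γ.continuous, hV.preimage γ.continuous])
    (by
      intro s _
      rcases hγ (mem_range_self s) with h | h
      · exact mem_iUnion.2 ⟨true, by simpa using h⟩
      · exact mem_iUnion.2 ⟨false, by simpa using h⟩)
  -- Along a subdivision into pieces lying in U or in V, the path so far is homotopic either to a
  -- path in U, or to a path in U followed by a pending piece in V that starts in U ∩ V.
  have key : ∀ n,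
      (∃ p : Path (γ 0) (γ (t n)), range p ⊆ U ∧ (γ.subpath 0 (t n)).Homotopic p) ∨
      (∃ y ∈ U ∩ V, ∃ p : Path (γ 0) y, range p ⊆ U ∧ ∃ q : Path y (γ (t n)), range q ⊆ V ∧
        (γ.subpath 0 (t n)).Homotopic (p.trans q)) := by
    intro n
    induction n with
    | zero =>
      left
      refine ⟨γ.subpath 0 (t 0), ?_, Path.Homotopic.refl _⟩
      rw [t0, Path.range_subpath]
      simpa using ha
    | succ n ih =>
      set τ := γ.subpath (t n) (t (n + 1)) with hτ
      have hs : (γ.subpath 0 (t (n + 1))).Homotopic ((γ.subpath 0 (t n)).trans τ) :=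
        Path.Homotopic.symm ⟨Path.Homotopy.subpathTransSubpath γ 0 (t n) (t (n + 1))⟩
      have hr : range τ = γ '' Icc (t n) (t (n + 1)) :=
        Path.range_subpath_of_le _ _ _ (tm n.le_succ)
      obtain ⟨i, hi⟩ := ht n
      have hn : γ (t n) ∈ range τ := ⟨0, τ.source⟩
      cases i with
      | true =>
        have hτU : range τ ⊆ U := by rw [hr, image_subset_iff]; simpa using hi
        left
        rcases ih with ⟨p, hp, hpγ⟩ | ⟨y, hy, p, hp, q, hq, hpq⟩
        · refine ⟨p.trans τ, ?_, hs.trans (hpγ.hcomp (Path.Homotopic.refl _))⟩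
          rw [Path.trans_range]; exact union_subset hp hτU
        -- The pending piece now ends in U ∩ V, so it may be replaced by a path inside U ∩ V and
        -- absorbed into the part in U.
        · obtain ⟨r, hr'⟩ := hUV y hy (γ (t n)) ⟨hτU hn, hq ⟨1, q.target⟩⟩
          have hqr : q.Homotopic r :=
            hVV q r hq (by rintro _ ⟨s, rfl⟩; exact (hr' s).2)
          refine ⟨(p.trans r).trans τ, ?_, hs.trans (Path.Homotopic.hcomp
            (hpq.trans ((Path.Homotopic.refl _).hcomp hqr)) (Path.Homotopic.refl _))⟩
          rw [Path.trans_range, Path.trans_range]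
          exact union_subset (union_subset hp (by rintro _ ⟨s, rfl⟩; exact (hr' s).1)) hτU
      | false =>
        have hτV : range τ ⊆ V := by rw [hr, image_subset_iff]; simpa using hi
        right
        rcases ih with ⟨p, hp, hpγ⟩ | ⟨y, hy, p, hp, q, hq, hpq⟩
        · exact ⟨γ (t n), ⟨hp ⟨1, p.target⟩, hτV hn⟩, p, hp, τ, hτV,
            hs.trans (hpγ.hcomp (Path.Homotopic.refl _))⟩
        · refine ⟨y, hy, p, hp, q.trans τ, ?_, (hs.trans
            (hpq.hcomp (Path.Homotopic.refl _))).trans ⟨Path.Homotopy.transAssoc _ _ _⟩⟩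
          rw [Path.trans_range]; exact union_subset hq hτV
  have hfin : ∃ p : Path (γ 0) (γ 1), range p ⊆ U ∧ (γ.subpath 0 1).Homotopic p := by
    have := key m
    rw [hm m le_rfl] at this
    rcases this with h | ⟨y, hy, p, hp, q, hq, hpq⟩
    · exact h
    · obtain ⟨r, hr'⟩ := hUV y hy (γ 1) ⟨by simpa using hb, hq ⟨1, q.target⟩⟩
      have hqr : q.Homotopic r := hVV q r hq (by rintro _ ⟨s, rfl⟩; exact (hr' s).2)
      refine ⟨p.trans r, ?_, hpq.trans ((Path.Homotopic.refl _).hcomp hqr)⟩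
      rw [Path.trans_range]
      exact union_subset hp (by rintro _ ⟨s, rfl⟩; exact (hr' s).1)
  obtain ⟨p, hp, h⟩ := hfin
  rw [Path.subpath_zero_one] at h
  refine ⟨p.cast γ.source.symm γ.target.symm, by simpa using hp, ?_⟩
  exact h.pathCast γ.source.symm γ.target.symm

/-- A set through which the inclusion factors via a simply connected space has homotopically unique
paths. -/
theorem pathsHomotopicIn_of_simplyConnected {X K : Type*} [TopologicalSpace X] [TopologicalSpace K]
    [SimplyConnectedSpace K] {V : Set X} {s : V → K} {r : K → X} (hs : Continuous s)
    (hr : Continuous r) (hrs : ∀ x, r (s x) = x) : PathsHomotopicIn V := by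
  intro a b γ γ' h h'
  have ha : a ∈ V := h ⟨0, γ.source⟩
  have hb : b ∈ V := h ⟨1, γ.target⟩
  let l (δ : Path a b) (hδ : range δ ⊆ V) : Path (⟨a, ha⟩ : V) ⟨b, hb⟩ :=
    { toFun := fun t => ⟨δ t, hδ (mem_range_self t)⟩
      continuous_toFun := by fun_prop
      source' := by simp
      target' := by simp }
  have hh := (SimplyConnectedSpace.paths_homotopic ((l γ h).map hs) ((l γ' h').map hs)).map
    ⟨r, hr⟩
  have := hh.pathCast (hrs ⟨a, ha⟩).symm (hrs ⟨b, hb⟩).symm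
  convert this using 1
  · ext t; exact (hrs ⟨γ t, h (mem_range_self t)⟩).symm
  · ext t; exact (hrs ⟨γ' t, h' (mem_range_self t)⟩).symm

/-- The convex set K makes paths in V unique up to homotopy in X, and K' is the image of U ∩ V in
the chart, from which it inherits path connectedness. -/
theorem pathsPushInto_of_chart {X E : Type*} [TopologicalSpace X] [AddCommGroup E]
    [TopologicalSpace E] [IsTopologicalAddGroup E] [Module ℝ E] [ContinuousSMul ℝ E]
    {U V : Set X} (hU : IsOpen U) (hV : IsOpen V) {K K' : Set E} (hK : Convex ℝ K)
    (hK' : IsPathConnected K') {s : V → K} {r : K → X} (hs : Continuous s)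
    (hr : Continuous r) (hrs : ∀ x, r (s x) = x) (hKK : K' ⊆ K)
    (hsU : ∀ x : V, x.1 ∈ U → (s x).1 ∈ K') (hrU : ∀ q : K, q.1 ∈ K' → r q ∈ U ∩ V) :
    PathsPushInto U (U ∪ V) := by
  obtain ⟨q₀, hq₀⟩ := hK'.nonempty
  have : ContractibleSpace K := hK.contractibleSpace ⟨q₀, hKK hq₀⟩
  refine pathsPushInto_union hU hV (pathsHomotopicIn_of_simplyConnected hs hr hrs) ?_ ?_
  · intro x hx
    refine ⟨r ⟨q₀, hKK hq₀⟩, (hrU _ hq₀).1, ?_⟩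
    have := (PathConnectedSpace.joined (s ⟨x, hx⟩) ⟨q₀, hKK hq₀⟩).map hr
    rwa [hrs] at this
  · rintro x ⟨hxU, hxV⟩ y ⟨hyU, hyV⟩
    have hj := hK'.joinedIn _ (hsU ⟨x, hxV⟩ hxU) _ (hsU ⟨y, hyV⟩ hyU)
    obtain ⟨p, hp⟩ := hj
    let p' : Path (s ⟨x, hxV⟩) (s ⟨y, hyV⟩) :=
      { toFun := fun t => ⟨p t, hKK (hp t)⟩
        continuous_toFun := by fun_prop
        source' := by simp
        target' := by simp }
    refine ⟨(p'.map hr).cast (hrs ⟨x, hxV⟩).symm (hrs ⟨y, hyV⟩).symm, fun t => ?_⟩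
    exact hrU (p' t) (hp t)

theorem simplyConnectedSpace_of_loops {X : Type*} [TopologicalSpace X] (x : X)
    (hx : ∀ y, Joined y x) (h : ∀ γ : Path x x, γ.Homotopic (Path.refl x)) :
    SimplyConnectedSpace X := by
  have : PathConnectedSpace X := ⟨⟨x⟩, fun y z => (hx y).trans (hx z).symm⟩
  have hs : Subsingleton (FundamentalGroup X x) := by
    refine ⟨fun a b => ?_⟩
    induction a using Path.Homotopic.Quotient.ind with | mk a =>
    induction b using Path.Homotopic.Quotient.ind with | mk b =>
    exact Path.Homotopic.Quotient.eq.2 ((h a).trans (h b).symm)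
  refine simply_connected_iff_loops_nullhomotopic.2 ⟨this, fun y γ => ?_⟩
  have hy : Subsingleton (FundamentalGroup X y) :=
    (FundamentalGroup.fundamentalGroupMulEquivOfPathConnected y x).toEquiv.subsingleton
  exact Path.Homotopic.Quotient.eq.1 (hy.elim (Path.Homotopic.Quotient.mk γ)
    (Path.Homotopic.Quotient.mk (Path.refl y)))

/-! ### Attaching cones along homotopic maps -/

/-- The space `Z` arises from `X` by attaching the cones on the fibres of `A → K` along
`φ : A → X`. The point of the cone at `a` and height `r` is `Φ (a, r)`, with apices at height `0`. -/
structure IsConeAttachment {A K X Z : Type} [TopologicalSpace A] [TopologicalSpace X]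
    [TopologicalSpace Z] (π : A → K) (φ : C(A, X)) (ι : C(X, Z)) (Φ : C(A × unitInterval, Z)) :
    Prop where
  apex : ∀ a b, π a = π b → Φ (a, 0) = Φ (b, 0)
  base : ∀ a, Φ (a, 1) = ι (φ a)
  surj : ∀ z, (∃ x, ι x = z) ∨ ∃ q, Φ q = z
  desc : ∀ (T : Type) [TopologicalSpace T] (f : C(X, T)) (h : C(A × unitInterval, T)),
    (∀ a b, π a = π b → h (a, 0) = h (b, 0)) → (∀ a, h (a, 1) = f (φ a)) →
      ∃ F : C(Z, T), (∀ x, F (ι x) = f x) ∧ ∀ q, F (Φ q) = h q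

namespace IsConeAttachment

variable {A K X Z Z₀ Z₁ : Type} [TopologicalSpace A] [TopologicalSpace X] [TopologicalSpace Z]
  [TopologicalSpace Z₀] [TopologicalSpace Z₁] {π : A → K}

open Classical in
/-- The cones, extended beyond their bases by the track of a homotopy of the attaching map. -/
noncomputable def extendedCone {φ φ' : C(A, X)} {ι : C(X, Z)} {Φ : C(A × unitInterval, Z)}
    (hΦ : ∀ a, Φ (a, 1) = ι (φ a)) (G : φ.Homotopy φ') : C(A × ℝ, Z) where
  toFun q := if q.2 ≤ 1 then Φ (q.1, projIcc 0 1 zero_le_one q.2)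
    else ι (G (projIcc 0 1 zero_le_one (q.2 - 1), q.1))
  continuous_toFun := by
    have hp : Continuous (projIcc (0 : ℝ) 1 zero_le_one) := continuous_projIcc
    refine Continuous.if_le (by fun_prop) (by fun_prop) (by fun_prop) (by fun_prop) ?_
    rintro ⟨a, r⟩ (rfl : r = 1)
    have h1 : projIcc (0 : ℝ) 1 zero_le_one 1 = 1 := projIcc_right ..
    have h0 : projIcc (0 : ℝ) 1 zero_le_one (1 - 1) = 0 := by
      rw [sub_self]; exact projIcc_left ..
    simp only [h1, h0, hΦ, G.apply_zero]

section

variable {φ φ' : C(A, X)} {ι : C(X, Z)} {Φ : C(A × unitInterval, Z)}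
    (hΦ : ∀ a, Φ (a, 1) = ι (φ a)) (G : φ.Homotopy φ')

theorem extendedCone_of_le (a : A) {r : ℝ} (hr : r ∈ Icc (0 : ℝ) 1) :
    extendedCone hΦ G (a, r) = Φ (a, ⟨r, hr⟩) := by
  simp [extendedCone, hr.2, projIcc_of_mem _ hr]

theorem extendedCone_of_ge (a : A) {r : ℝ} (hr : r - 1 ∈ Icc (0 : ℝ) 1) :
    extendedCone hΦ G (a, r) = ι (G (⟨r - 1, hr⟩, a)) := by
  rcases eq_or_lt_of_le hr.1 with h | h
  · obtain rfl : r = 1 := by linarith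
    have : (⟨(1 : ℝ) - 1, hr⟩ : unitInterval) = 0 := Subtype.ext (sub_self 1)
    rw [extendedCone_of_le hΦ G a ⟨zero_le_one, le_rfl⟩, this, G.apply_zero]
    exact hΦ a
  · have : ¬ r ≤ 1 := by linarith
    simp [extendedCone, this, projIcc_of_mem _ hr]

theorem extendedCone_zero (a : A) : extendedCone hΦ G (a, 0) = Φ (a, 0) :=
  extendedCone_of_le hΦ G a ⟨le_rfl, zero_le_one⟩

theorem extendedCone_one (a : A) : extendedCone hΦ G (a, 1) = ι (φ a) :=
  (extendedCone_of_le hΦ G a ⟨zero_le_one, le_rfl⟩).trans (hΦ a)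

theorem extendedCone_two (a : A) : extendedCone hΦ G (a, 2) = ι (φ' a) := by
  have h : (2 : ℝ) - 1 ∈ Icc (0 : ℝ) 1 := by norm_num
  rw [extendedCone_of_ge hΦ G a h]
  have : (⟨(2 : ℝ) - 1, h⟩ : unitInterval) = 1 := Subtype.ext (by norm_num)
  rw [this, G.apply_one]

end

variable {φ₀ φ₁ : C(A, X)} {ι₀ : C(X, Z₀)} {ι₁ : C(X, Z₁)} {Φ₀ : C(A × unitInterval, Z₀)}
  {Φ₁ : C(A × unitInterval, Z₁)}

/-- The cone over a ↦ φ₀ a is mapped to the cone of Z₁ prolonged by a collar, the track of the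
homotopy from φ₁ to φ₀; heights are doubled because the prolonged cone has height 2. -/
theorem exists_map (h₀ : IsConeAttachment π φ₀ ι₀ Φ₀) (h₁ : IsConeAttachment π φ₁ ι₁ Φ₁)
    (G : φ₁.Homotopy φ₀) : ∃ F : C(Z₀, Z₁), (∀ x, F (ι₀ x) = ι₁ x) ∧
      ∀ q, F (Φ₀ q) = extendedCone h₁.base G (q.1, 2 * (q.2 : ℝ)) := by
  refine h₀.desc Z₁ ι₁ ⟨fun q => extendedCone h₁.base G (q.1, 2 * (q.2 : ℝ)), by fun_prop⟩ ?_ ?_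
  · intro a b hab
    simp [extendedCone_zero, h₁.apex a b hab]
  · intro a
    simp [extendedCone_two]

/-- The composite climbs the cone, runs out along the collar and comes back: height r goes to height
min (4r, 3 - 2r) of the prolonged cone. Linear interpolation to height r keeps 0 and 1 fixed, hence
respects apices and bases. -/
theorem comp_homotopic_id (h₀ : IsConeAttachment π φ₀ ι₀ Φ₀) (h₁ : IsConeAttachment π φ₁ ι₁ Φ₁)
    (G : φ₀.Homotopy φ₁) {F : C(Z₀, Z₁)} (hF : ∀ x, F (ι₀ x) = ι₁ x)
    (hF' : ∀ q, F (Φ₀ q) = extendedCone h₁.base G.symm (q.1, 2 * (q.2 : ℝ)))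
    {F' : C(Z₁, Z₀)} (hF₁ : ∀ x, F' (ι₁ x) = ι₀ x)
    (hF₁' : ∀ q, F' (Φ₁ q) = extendedCone h₀.base G (q.1, 2 * (q.2 : ℝ))) :
    (F'.comp F).Homotopic (ContinuousMap.id Z₀) := by
  have hcomp : ∀ q, F' (F (Φ₀ q)) =
      extendedCone h₀.base G (q.1, min (4 * (q.2 : ℝ)) (3 - 2 * q.2)) := by
    rintro ⟨a, r, hr⟩
    rw [hF']
    rcases le_total (2 * r) 1 with h | h
    · have h2 : 2 * r ∈ Icc (0 : ℝ) 1 := ⟨by linarith [hr.1], h⟩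
      rw [extendedCone_of_le _ _ _ h2, hF₁', min_eq_left (by simp only; linarith)]
      simp only
      congr 2
      ring
    · have h2 : 2 * r - 1 ∈ Icc (0 : ℝ) 1 := ⟨by linarith, by linarith [hr.2]⟩
      have h3 : (3 - 2 * r) - 1 ∈ Icc (0 : ℝ) 1 := ⟨by linarith [hr.2], by linarith⟩
      rw [extendedCone_of_ge _ _ _ h2, hF₁, min_eq_right (by simp only; linarith)]
      simp only
      rw [extendedCone_of_ge _ _ _ h3, ContinuousMap.Homotopy.symm_apply]
      congr 3
      ext
      simp only [unitInterval.coe_symm_eq]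
      ring
  -- Mapping into the path space makes the universal property of Z₀ itself yield the homotopy; none
  -- is needed for Z₀ × [0, 1].
  obtain ⟨J, hJ, hJ'⟩ := h₀.desc C(unitInterval, Z₀)
    ⟨fun x => ContinuousMap.const _ (ι₀ x), by fun_prop⟩
    (ContinuousMap.curry ⟨fun q : (A × unitInterval) × unitInterval =>
      extendedCone h₀.base G (q.1.1, (1 - (q.2 : ℝ)) * min (4 * (q.1.2 : ℝ)) (3 - 2 * q.1.2)
        + q.2 * q.1.2), by fun_prop⟩)
    (by
      intro a b hab
      ext s
      simp [extendedCone_zero, h₀.apex a b hab])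
    (by
      intro a
      ext s
      have : (1 - (s : ℝ)) * min 4 (3 - 2) + s = 1 := by norm_num
      simp [this, extendedCone_one])
  refine ⟨⟨⟨fun q => J q.2 q.1, by fun_prop⟩, ?_, ?_⟩⟩
  · intro z
    rcases h₀.surj z with ⟨x, rfl⟩ | ⟨q, rfl⟩
    · simp [hJ, hF, hF₁]
    · simp [hJ', hcomp]
  · intro z
    rcases h₀.surj z with ⟨x, rfl⟩ | ⟨⟨a, r⟩, rfl⟩
    · simp [hJ]
    · simp [hJ', extendedCone_of_le h₀.base G a r.2]

/-- Homotopic attaching maps give homotopy equivalent spaces. -/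
theorem nonempty_homotopyEquiv (h₀ : IsConeAttachment π φ₀ ι₀ Φ₀)
    (h₁ : IsConeAttachment π φ₁ ι₁ Φ₁) (G : φ₀.Homotopy φ₁) : Nonempty (Z₀ ≃ₕ Z₁) := by
  obtain ⟨F, hF, hF'⟩ := h₀.exists_map h₁ G.symm
  obtain ⟨F', hF₁, hF₁'⟩ := h₁.exists_map h₀ G
  refine ⟨⟨F, F', h₀.comp_homotopic_id h₁ G hF hF' hF₁ hF₁',
    h₁.comp_homotopic_id h₀ G.symm hF₁ ?_ hF hF'⟩⟩
  simpa using hF₁'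

end IsConeAttachment

namespace SL3

attribute [local instance] LieRing.ofAssociativeRing

/-! ### Plücker coordinates of abelian planes -/

/-- Linear coordinates on the Borel subalgebra. -/
def coord : Mat →ₗ[ℝ] (Fin 5 → ℝ) where
  toFun X := ![X 1 1 - X 0 0, X 2 2 - X 0 0, X 0 1, X 1 2, X 0 2]
  map_add' X Z := by ext i; fin_cases i <;> simp <;> ring
  map_smul' c X := by ext i; fin_cases i <;> simp <;> ring

/-- The element of the Borel subalgebra with given coordinates. -/
noncomputable def ofCoord : (Fin 5 → ℝ) →ₗ[ℝ] Mat where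
  toFun x := !![-(x 0 + x 1) / 3, x 2, x 4; 0, x 0 - (x 0 + x 1) / 3, x 3;
    0, 0, x 1 - (x 0 + x 1) / 3]
  map_add' X Z := by ext i j; fin_cases i <;> fin_cases j <;> simp <;> ring
  map_smul' c X := by ext i j; fin_cases i <;> fin_cases j <;> simp <;> ring

theorem mem_borel_iff {X : Mat} : X ∈ borel ↔
    X 0 0 + X 1 1 + X 2 2 = 0 ∧ X 1 0 = 0 ∧ X 2 0 = 0 ∧ X 2 1 = 0 := by
  change (X ∈ LieAlgebra.SpecialLinear.sl (Fin 3) ℝ ∧ X.BlockTriangular id) ↔ _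
  have h : X ∈ LieAlgebra.SpecialLinear.sl (Fin 3) ℝ ↔ X 0 0 + X 1 1 + X 2 2 = 0 := by
    rw [← Matrix.trace_fin_three]; exact LinearMap.mem_ker
  rw [h, Matrix.BlockTriangular]
  refine and_congr_right fun _ => ⟨fun h => ⟨h (by decide), h (by decide), h (by decide)⟩, ?_⟩
  rintro ⟨h1, h2, h3⟩ i j hij
  fin_cases i <;> fin_cases j <;> first | assumption | exact absurd hij (by decide)

@[simp] theorem coord_ofCoord (x : Fin 5 → ℝ) : coord (ofCoord x) = x := by
  ext i; fin_cases i <;> simp [coord, ofCoord] <;> ring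

theorem ofCoord_mem_borel (x : Fin 5 → ℝ) : ofCoord x ∈ borel := by
  rw [mem_borel_iff]; simp [ofCoord]; ring

theorem ofCoord_coord {X : Mat} (hX : X ∈ borel) : ofCoord (coord X) = X := by
  obtain ⟨h, h1, h2, h3⟩ := mem_borel_iff.1 hX
  ext i j; fin_cases i <;> fin_cases j <;> simp [coord, ofCoord, h1, h2, h3] <;> linarith

theorem continuous_coord : Continuous coord := LinearMap.continuous_of_finiteDimensional _

theorem continuous_ofCoord : Continuous ofCoord := LinearMap.continuous_of_finiteDimensional _

/-- In terms of the minors wᵢⱼ the three equations read w₀₂ = 0, w₀₃ = w₁₃ and w₁₄ = w₂₃. -/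
theorem lie_eq_zero_iff {X Z : Mat} (hX : X ∈ borel) (hZ : Z ∈ borel) : ⁅X, Z⁆ = 0 ↔
    coord X 0 * coord Z 2 - coord X 2 * coord Z 0 = 0 ∧
    coord X 0 * coord Z 3 - coord X 3 * coord Z 0 = coord X 1 * coord Z 3 - coord X 3 * coord Z 1 ∧
    coord X 1 * coord Z 4 - coord X 4 * coord Z 1 =
      coord X 2 * coord Z 3 - coord X 3 * coord Z 2 := by
  obtain ⟨h, h1, h2, h3⟩ := mem_borel_iff.1 hX
  obtain ⟨k, k1, k2, k3⟩ := mem_borel_iff.1 hZ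
  rw [Ring.lie_def, ← Matrix.ext_iff]
  simp only [Fin.forall_fin_succ, Matrix.sub_apply, Matrix.mul_apply, Fin.sum_univ_three, coord]
  simp [h1, h2, h3, k1, k2, k3]
  constructor
  · rintro ⟨⟨-, a, b⟩, ⟨-, c⟩, -⟩
    refine ⟨?_, ?_, ?_⟩ <;> linarith
  · rintro ⟨a, b, c⟩
    refine ⟨⟨by ring, ?_, ?_⟩, ⟨by ring, ?_⟩, by ring⟩ <;> linarith

/-- The skew matrix of minors, with the three linear equations for commuting built in: this is why p
2 and p 4 occur twice above the diagonal and why one entry there vanishes. -/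
def bivector (p : Fin 7 → ℝ) : Matrix (Fin 5) (Fin 5) ℝ :=
  !![0, p 0, 0, p 2, p 3; -p 0, 0, p 1, p 2, p 4; 0, -p 1, 0, p 4, p 5;
    -p 2, -p 2, -p 4, 0, p 6; -p 3, -p 4, -p 5, -p 6, 0]

/-- One relation for each four of the five indices; `r0` to `r4` omit the index 4, 3, 2, 1, 0
respectively. -/
structure PluckerRel (p : Fin 7 → ℝ) : Prop where
  r0 : p 0 * p 4 + p 1 * p 2 = 0
  r1 : p 0 * p 5 + p 1 * p 3 = 0
  r2 : p 0 * p 6 - p 2 * p 4 + p 2 * p 3 = 0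
  r3 : p 3 * p 4 - p 2 * p 5 = 0
  r4 : p 1 * p 6 - p 2 * p 5 + p 4 * p 4 = 0

set_option maxHeartbeats 4000000 in
theorem PluckerRel.plucker {p : Fin 7 → ℝ} (h : PluckerRel p) (i j k m : Fin 5) :
    bivector p i j * bivector p k m - bivector p i k * bivector p j m
      + bivector p i m * bivector p j k = 0 := by
  obtain ⟨h0, h1, h2, h3, h4⟩ := h
  fin_cases i <;> fin_cases j <;> fin_cases k <;> fin_cases m <;>
  simp [bivector] <;> first | ring1 | linarith

theorem bivector_swap (p : Fin 7 → ℝ) (i j : Fin 5) : bivector p j i = -bivector p i j := by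
  fin_cases i <;> fin_cases j <;> simp [bivector]

theorem exists_bivector_ne_zero {p : Fin 7 → ℝ} (hp : p ≠ 0) : ∃ a b, bivector p a b ≠ 0 := by
  by_contra! h
  apply hp
  ext i
  fin_cases i
  · simpa [bivector] using h 0 1
  · simpa [bivector] using h 1 2
  · simpa [bivector] using h 0 3
  · simpa [bivector] using h 0 4
  · simpa [bivector] using h 1 4
  · simpa [bivector] using h 2 4
  · simpa [bivector] using h 3 4

/-- The subspace of the vectors in `𝔟` whose wedge product with the bivector of `p` vanishes. -/
def plane (p : Fin 7 → ℝ) : Submodule ℝ Mat where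
  carrier := {X | X ∈ borel ∧ ∀ i j k,
    bivector p i j * coord X k + bivector p j k * coord X i + bivector p k i * coord X j = 0}
  add_mem' hX hZ := ⟨add_mem hX.1 hZ.1, fun i j k => by
    simp only [map_add, Pi.add_apply]; linear_combination hX.2 i j k + hZ.2 i j k⟩
  zero_mem' := ⟨zero_mem _, fun i j k => by simp⟩
  smul_mem' c X hX := ⟨Submodule.smul_mem borel.toSubmodule c hX.1, fun i j k => by
    simp only [map_smul, Pi.smul_apply, smul_eq_mul]; linear_combination c * hX.2 i j k⟩

theorem mem_plane {p : Fin 7 → ℝ} {X : Mat} : X ∈ plane p ↔ X ∈ borel ∧ ∀ i j k,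
    bivector p i j * coord X k + bivector p j k * coord X i + bivector p k i * coord X j = 0 :=
  Iff.rfl

/-- A row is the contraction of the bivector with a basis covector; for a decomposable bivector it
lies in the plane. -/
theorem ofCoord_row_mem_plane {p : Fin 7 → ℝ} (hp : PluckerRel p) (m : Fin 5) :
    ofCoord (bivector p m) ∈ plane p := by
  refine ⟨ofCoord_mem_borel _, fun i j k => ?_⟩
  rw [coord_ofCoord]
  have := hp.plucker i j k m
  rw [bivector_swap p k m, bivector_swap p i m, bivector_swap p j m, bivector_swap p i k]
  linear_combination -this

theorem eq_of_mem_plane {p : Fin 7 → ℝ} {a b : Fin 5} (hab : bivector p a b ≠ 0) {X : Mat}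
    (hX : X ∈ plane p) : X = (coord X b / bivector p a b) • ofCoord (bivector p a) +
      (-coord X a / bivector p a b) • ofCoord (bivector p b) := by
  rw [← map_smul, ← map_smul, ← map_add, ← ofCoord_coord hX.1]
  congr 1
  rw [ofCoord_coord hX.1]
  ext k
  have := hX.2 a b k
  rw [bivector_swap p a k] at this
  simp only [Pi.add_apply, Pi.smul_apply, smul_eq_mul]
  field_simp
  linear_combination this

theorem plane_eq_span {p : Fin 7 → ℝ} (hp : PluckerRel p) {a b : Fin 5}
    (hab : bivector p a b ≠ 0) :
    plane p = Submodule.span ℝ {ofCoord (bivector p a), ofCoord (bivector p b)} := by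
  apply le_antisymm
  · intro X hX
    exact Submodule.mem_span_pair.2 ⟨_, _, (eq_of_mem_plane hab hX).symm⟩
  · rw [Submodule.span_le]
    rintro _ (rfl | rfl) <;> exact ofCoord_row_mem_plane hp _

theorem linearIndependent_rows {p : Fin 7 → ℝ} {a b : Fin 5} (hab : bivector p a b ≠ 0) :
    LinearIndependent ℝ ![ofCoord (bivector p a), ofCoord (bivector p b)] := by
  rw [LinearIndependent.pair_iff]
  intro s t h
  rw [← map_smul, ← map_smul, ← map_add] at h
  have h' := congrArg coord h
  rw [coord_ofCoord, map_zero] at h'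
  have ha := congrFun h' a
  have hb := congrFun h' b
  have haa : bivector p a a = 0 := by have := bivector_swap p a a; linarith
  have hbb : bivector p b b = 0 := by have := bivector_swap p b b; linarith
  have hba := bivector_swap p a b
  simp only [Pi.add_apply, Pi.smul_apply, smul_eq_mul, Pi.zero_apply, haa, hbb, hba] at ha hb
  constructor
  · simpa [hab] using hb
  · simpa [hab] using ha

theorem finrank_plane {p : Fin 7 → ℝ} (hp : PluckerRel p) (h0 : p ≠ 0) :
    Module.finrank ℝ (plane p) = 2 := by
  obtain ⟨a, b, hab⟩ := exists_bivector_ne_zero h0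
  rw [plane_eq_span hp hab]
  have := finrank_span_eq_card (linearIndependent_rows hab)
  rwa [Matrix.range_cons, Matrix.range_cons, Matrix.range_empty, union_empty, singleton_union,
    Fintype.card_fin] at this

/-- By the Plücker relations the wedge of rows a and b is the entry (a, b) times the bivector
itself, and that bivector satisfies the commuting equations by its shape. -/
theorem lie_rows {p : Fin 7 → ℝ} (hp : PluckerRel p) (a b : Fin 5) :
    ⁅ofCoord (bivector p a), ofCoord (bivector p b)⁆ = 0 := by
  have key : ∀ i j, bivector p a i * bivector p b j - bivector p a j * bivector p b i =
      bivector p a b * bivector p i j := fun i j => by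
    have := hp.plucker a b i j
    rw [bivector_swap p i b] at *
    linear_combination -this
  rw [lie_eq_zero_iff (ofCoord_mem_borel _) (ofCoord_mem_borel _)]
  simp only [coord_ofCoord]
  have e (i j : Fin 5) : bivector p a i * bivector p b j - bivector p a j * bivector p b i =
      bivector p a b * bivector p i j := key i j
  rw [e, e, e, e, e]
  simp [bivector]

theorem lie_eq_zero_of_mem_plane {p : Fin 7 → ℝ} (hp : PluckerRel p) (h0 : p ≠ 0) {X Z : Mat}
    (hX : X ∈ plane p) (hZ : Z ∈ plane p) : ⁅X, Z⁆ = 0 := by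
  obtain ⟨a, b, hab⟩ := exists_bivector_ne_zero h0
  rw [eq_of_mem_plane hab hX, eq_of_mem_plane hab hZ]
  have h := lie_rows hp a b
  have h' := lie_rows hp b a
  simp only [Ring.lie_def] at h h' ⊢
  simp only [mul_add, add_mul, smul_mul_smul_comm, ]
  rw [sub_eq_zero] at h h'
  rw [h]
  module

/-- The nonzero vectors of Plücker coordinates of abelian planes. -/
def Cone : Type := {p : Fin 7 → ℝ // p ≠ 0 ∧ PluckerRel p}

instance : TopologicalSpace Cone := instTopologicalSpaceSubtype

/-- The point of `Y` with given Plücker coordinates. -/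
def toY (p : Cone) : Y :=
  ⟨plane p.1, fun _ hX => hX.1, fun _ hX _ hZ => lie_eq_zero_of_mem_plane p.2.2 p.2.1 hX hZ,
    finrank_plane p.2.2 p.2.1⟩

theorem PluckerRel.smul {p : Fin 7 → ℝ} (hp : PluckerRel p) (c : ℝ) : PluckerRel (c • p) := by
  obtain ⟨h0, h1, h2, h3, h4⟩ := hp
  constructor <;> simp only [Pi.smul_apply, smul_eq_mul]
  · linear_combination c ^ 2 * h0
  · linear_combination c ^ 2 * h1
  · linear_combination c ^ 2 * h2
  · linear_combination c ^ 2 * h3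
  · linear_combination c ^ 2 * h4

theorem bivector_smul (c : ℝ) (p : Fin 7 → ℝ) : bivector (c • p) = c • bivector p := by
  ext i j; fin_cases i <;> fin_cases j <;> simp [bivector]

theorem bivector_injective : Function.Injective bivector := by
  intro p q h
  have e (i j : Fin 5) : bivector p i j = bivector q i j := by rw [h]
  ext i
  fin_cases i
  · simpa [bivector] using e 0 1
  · simpa [bivector] using e 1 2
  · simpa [bivector] using e 0 3
  · simpa [bivector] using e 0 4
  · simpa [bivector] using e 1 4
  · simpa [bivector] using e 2 4
  · simpa [bivector] using e 3 4

theorem plane_smul {c : ℝ} (hc : c ≠ 0) (p : Fin 7 → ℝ) : plane (c • p) = plane p := by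
  ext X
  simp only [mem_plane, bivector_smul, Matrix.smul_apply, smul_eq_mul]
  refine and_congr_right fun _ => forall₃_congr fun i j k => ?_
  constructor
  · intro h
    apply mul_left_cancel₀ hc
    linear_combination h
  · intro h
    linear_combination c * h

/-- The Plücker coordinates of a plane are unique up to scaling. -/
theorem exists_smul_of_plane_eq {p q : Fin 7 → ℝ} (hp : PluckerRel p) (p0 : p ≠ 0) (q0 : q ≠ 0)
    (hq : PluckerRel q) (h : plane p = plane q) : ∃ c : ℝ, c ≠ 0 ∧ p = c • q := by
  obtain ⟨a, b, hab⟩ := exists_bivector_ne_zero p0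
  obtain ⟨a', b', hab'⟩ := exists_bivector_ne_zero q0
  have h1 := congrArg coord (eq_of_mem_plane hab' (h ▸ ofCoord_row_mem_plane hp a))
  have h2 := congrArg coord (eq_of_mem_plane hab' (h ▸ ofCoord_row_mem_plane hp b))
  simp only [map_add, map_smul, coord_ofCoord] at h1 h2
  generalize bivector p a b' / bivector q a' b' = s at h1
  generalize -bivector p a a' / bivector q a' b' = t at h1
  generalize bivector p b b' / bivector q a' b' = u at h2
  generalize -bivector p b a' / bivector q a' b' = v at h2
  -- The wedge of rows a and b of p is p_{ab} p, and likewise for q. Writing the rows of p in those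
  -- of q multiplies the wedge by the determinant s v - t u.
  have key : p = ((s * v - t * u) * bivector q a' b' / bivector p a b) • q := by
    apply bivector_injective
    rw [bivector_smul]
    ext i j
    have e1 := hp.plucker a b i j
    have e2 := hq.plucker a' b' i j
    have f1 := congrFun h1 i
    have f2 := congrFun h1 j
    have f3 := congrFun h2 i
    have f4 := congrFun h2 j
    simp only [Pi.add_apply, Pi.smul_apply, smul_eq_mul] at f1 f2 f3 f4
    rw [Matrix.smul_apply, smul_eq_mul]
    rw [f1, f2, f3, f4] at e1
    field_simp
    linear_combination e1 - (s * v - t * u) * e2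
  refine ⟨_, ?_, key⟩
  rintro hc
  rw [hc, zero_smul] at key
  exact p0 key

/-- Every abelian plane has Plücker coordinates. -/
theorem toY_surjective : Function.Surjective toY := by
  rintro ⟨l, hb, hl, hd⟩
  obtain ⟨X, Z, hXZ⟩ : ∃ X Z : l, LinearIndependent ℝ ![X, Z] := by
    let e := Module.finBasisOfFinrankEq ℝ l hd
    refine ⟨e 0, e 1, ?_⟩
    convert e.linearIndependent using 1
    ext i; fin_cases i <;> rfl
  have hX := hb X.2
  have hZ := hb Z.2
  obtain ⟨e1, e2, e3⟩ := (lie_eq_zero_iff hX hZ).1 (hl X X.2 Z Z.2)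
  set x := coord X with hx
  set z := coord Z with hz
  let w (i j : Fin 5) : ℝ := x i * z j - x j * z i
  let p : Fin 7 → ℝ := ![w 0 1, w 1 2, w 0 3, w 0 4, w 1 4, w 2 4, w 3 4]
  have hp : PluckerRel p := by
    constructor <;> simp only [p, w, Matrix.cons_val]
    · linear_combination (w 0 1) * e3 + (w 1 3) * e1
    · linear_combination (w 1 4) * e1
    · linear_combination (w 0 4) * e2
    · linear_combination (w 0 4) * e3 - (w 3 4) * e1
    · linear_combination (w 1 4) * e3 - (w 2 4) * e2
  have hw : ∀ i j, bivector p i j = w i j := by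
    intro i j
    fin_cases i <;> fin_cases j <;> simp [bivector, p, w] <;> linarith
  have hXp : (X : Mat) ∈ plane p := ⟨hX, fun i j k => by simp only [hw, w, ← hx]; ring⟩
  have hZp : (Z : Mat) ∈ plane p := ⟨hZ, fun i j k => by simp only [hw, w, ← hz]; ring⟩
  have hle : l ≤ plane p := by
    intro V hV
    have htop := hXZ.span_eq_top_of_card_eq_finrank (by simp [hd])
    rw [Matrix.range_cons, Matrix.range_cons, Matrix.range_empty, union_empty,
      singleton_union] at htop
    have hV' : (⟨V, hV⟩ : l) ∈ Submodule.span ℝ {X, Z} := htop ▸ Submodule.mem_top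
    obtain ⟨s, t, hst⟩ := Submodule.mem_span_pair.1 hV'
    rw [show V = s • (X : Mat) + t • (Z : Mat) from (congrArg Subtype.val hst).symm]
    exact add_mem (Submodule.smul_mem _ _ hXp) (Submodule.smul_mem _ _ hZp)
  have h0 : p ≠ 0 := by
    intro hp0
    have hw0 : ∀ i j, x i * z j - x j * z i = 0 := fun i j => by
      have h := hw i j
      change w i j = 0
      rw [← h, hp0]
      simpa using congrFun (congrFun (bivector_smul 0 (0 : Fin 7 → ℝ)) i) j
    have hX0 : X ≠ 0 := hXZ.ne_zero 0
    obtain ⟨a, ha⟩ : ∃ a, x a ≠ 0 := by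
      by_contra! hx0
      apply hX0
      ext1
      rw [← ofCoord_coord hX, ← hx, show x = 0 from funext hx0, map_zero]
      rfl
    -- If all minors vanish, two vectors are proportional; a nonzero coordinate of X gives an
    -- explicit nontrivial relation.
    have hdep : (-z a) • X + x a • Z = 0 := by
      ext1
      have hXe : (X : Mat) = ofCoord x := (ofCoord_coord hX).symm
      have hZe : (Z : Mat) = ofCoord z := (ofCoord_coord hZ).symm
      change (-z a) • (X : Mat) + x a • (Z : Mat) = 0
      rw [hXe, hZe, ← map_smul ofCoord, ← map_smul ofCoord, ← map_add]
      have : (-z a) • x + x a • z = 0 := by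
        ext j
        simp only [Pi.add_apply, Pi.smul_apply, smul_eq_mul, Pi.zero_apply]
        linear_combination hw0 a j
      rw [this, map_zero]
    exact ha (LinearIndependent.pair_iff.1 hXZ _ _ hdep).2
  refine ⟨⟨p, h0, hp⟩, Subtype.ext (Submodule.eq_of_le_of_finrank_eq hle ?_).symm⟩
  rw [hd, finrank_plane hp h0]

/-! ### Plücker coordinates and the Chabauty topology -/

theorem continuous_bivector_apply (i j : Fin 5) :
    Continuous fun p : Fin 7 → ℝ => bivector p i j := by
  fin_cases i <;> fin_cases j <;> simp [bivector] <;> fun_prop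

/-- Meeting a compact K is a closed condition, because projecting along a compact factor is a closed
map. Meeting an open set is stable, because a vector of one plane extends to a continuous choice of
vectors in nearby planes, by the formula of `eq_of_mem_plane`. -/
theorem continuous_toY : Continuous toY := by
  refine continuous_induced_rng.2 (continuous_generateFrom_iff.2 ?_)
  rintro _ (⟨K, hK, rfl⟩ | ⟨U, hU, rfl⟩)
  · have hclosed : IsClosed {q : Cone × K | (q.2 : Mat) ∈ plane q.1.1} := by
      have hb : IsClosed (borel : Set Mat) := borel.toSubmodule.closed_of_finiteDimensional
      have h (i j k : Fin 5) : IsClosed {q : Cone × K | bivector q.1.1 i j * coord q.2 k +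
          bivector q.1.1 j k * coord q.2 i + bivector q.1.1 k i * coord q.2 j = 0} := by
        have hc (k : Fin 5) : Continuous fun q : Cone × K => coord q.2 k :=
          (continuous_apply k).comp (continuous_coord.comp (by fun_prop))
        have hw (i j : Fin 5) : Continuous fun q : Cone × K => bivector q.1.1 i j :=
          (continuous_bivector_apply i j).comp (continuous_subtype_val.comp continuous_fst)
        exact isClosed_eq ((((hw i j).mul (hc k)).add ((hw j k).mul (hc i))).add
          ((hw k i).mul (hc j))) continuous_const
      have := (hb.preimage (f := fun q : Cone × K => (q.2 : Mat)) (by fun_prop)).inter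
        (isClosed_iInter fun i => isClosed_iInter fun j => isClosed_iInter fun k => h i j k)
      convert this using 1
      ext q
      simp [mem_plane]
    have : CompactSpace K := isCompact_iff_compactSpace.1 hK
    have h2 := (isClosedMap_fst_of_compactSpace (X := Cone) (Y := K)) _ hclosed
    convert h2.isOpen_compl using 1
    ext p
    simp only [mem_preimage, mem_ofPred_eq, Set.disjoint_left, mem_compl_iff, mem_image, Prod.exists,
      exists_and_right, exists_eq_right, Subtype.exists, not_exists]
    constructor
    · intro h X hX hXp
      exact h hXp hX
    · intro h X hXp hX
      exact h X hX hXp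
  · rw [isOpen_iff_mem_nhds]
    rintro p ⟨X, hX, hXU⟩
    replace hX : X ∈ plane p.1 := hX
    obtain ⟨a, b, hab⟩ := exists_bivector_ne_zero p.2.1
    have hw (i j : Fin 5) : Continuous fun q : Cone => bivector q.1 i j :=
      (continuous_bivector_apply i j).comp continuous_subtype_val
    have hrow (i : Fin 5) : Continuous fun q : Cone => ofCoord (bivector q.1 i) :=
      continuous_ofCoord.comp (continuous_pi fun j => hw i j)
    let f : Cone → Mat := fun q => (coord X b / bivector q.1 a b) • ofCoord (bivector q.1 a) +
      (-coord X a / bivector q.1 a b) • ofCoord (bivector q.1 b)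
    have hf : ContinuousAt f p :=
      ((continuousAt_const.div (hw a b).continuousAt hab).smul (hrow a).continuousAt).add
        ((continuousAt_const.div (hw a b).continuousAt hab).smul (hrow b).continuousAt)
    have hfX : f p = X := (eq_of_mem_plane hab hX).symm
    have hfp : f p ∈ U := hfX ▸ hXU
    filter_upwards [hf.preimage_mem_nhds (hU.mem_nhds hfp)] with q hq
    refine ⟨f q, ?_, hq⟩
    exact add_mem (Submodule.smul_mem _ _ (ofCoord_row_mem_plane q.2.2 a))
      (Submodule.smul_mem _ _ (ofCoord_row_mem_plane q.2.2 b))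

instance : T2Space Y := by
  have : LocallyCompactSpace Mat := inferInstanceAs (LocallyCompactSpace (Fin 3 → Fin 3 → ℝ))
  -- A vector of l outside l' has a compact neighbourhood K missing l'; meeting the interior of K
  -- and missing K separate the two planes.
  have key : ∀ l l' : Y, ¬ l.1 ≤ l'.1 → ∃ u v : Set Y, IsOpen u ∧ IsOpen v ∧ l ∈ u ∧ l' ∈ v ∧
      Disjoint u v := by
    intro l l' h
    obtain ⟨X, hX, hX'⟩ := SetLike.not_le_iff_exists.1 h
    have hc : IsClosed (l'.1 : Set Mat) := l'.1.closed_of_finiteDimensional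
    obtain ⟨K, hK, hXK, hKl⟩ := exists_compact_subset hc.isOpen_compl hX'
    refine ⟨Y.toClosedAddSubgroup ⁻¹' {H | ((H : Set Mat) ∩ interior K).Nonempty},
      Y.toClosedAddSubgroup ⁻¹' {H | Disjoint (H : Set Mat) K}, ?_, ?_, ⟨X, hX, hXK⟩, ?_, ?_⟩
    · exact (isOpen_induced_iff (t := chabautyTopology Mat)).2 ⟨_, TopologicalSpace.isOpen_generateFrom_of_mem
        (Or.inr ⟨_, isOpen_interior, rfl⟩), rfl⟩
    · exact (isOpen_induced_iff (t := chabautyTopology Mat)).2 ⟨_, TopologicalSpace.isOpen_generateFrom_of_mem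
        (Or.inl ⟨K, hK, rfl⟩), rfl⟩
    · exact Set.disjoint_right.2 fun Z hZ => hKl hZ
    · rw [Set.disjoint_left]
      rintro m ⟨Z, hZ, hZK⟩ hm
      exact Set.disjoint_left.1 hm hZ (interior_subset hZK)
  refine ⟨fun l l' hne => ?_⟩
  by_cases h : l.1 ≤ l'.1
  · have h' : ¬ l'.1 ≤ l.1 := fun h' => hne (Subtype.ext (le_antisymm h h'))
    obtain ⟨u, v, hu, hv, h1, h2, h3⟩ := key l' l h'
    exact ⟨v, u, hv, hu, h2, h1, h3.symm⟩
  · exact key l l' h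

/-! ### The cone of Plücker coordinates is simply connected -/

theorem continuous_cone_apply (i : Fin 7) : Continuous fun p : Cone => p.1 i :=
  (continuous_apply i).comp continuous_subtype_val

theorem continuous_vec_seven {X : Type*} [TopologicalSpace X] {f₀ f₁ f₂ f₃ f₄ f₅ f₆ : X → ℝ}
    (h₀ : Continuous f₀) (h₁ : Continuous f₁) (h₂ : Continuous f₂) (h₃ : Continuous f₃)
    (h₄ : Continuous f₄) (h₅ : Continuous f₅) (h₆ : Continuous f₆) :
    Continuous fun x => (![f₀ x, f₁ x, f₂ x, f₃ x, f₄ x, f₅ x, f₆ x] : Fin 7 → ℝ) := by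
  refine continuous_pi fun i => ?_
  fin_cases i <;> simpa

/-! ### Contractible charts of the cone -/

/-- The domain of the charts. -/
def chartDomain (ε : ℝ) : Set (ℝ × ℝ × ℝ × ℝ) := {q | 0 < ε * q.1}

theorem convex_chartDomain (ε : ℝ) : Convex ℝ (chartDomain ε) := by
  rintro ⟨x, x'⟩ hx ⟨y, y'⟩ hy a b ha hb hab
  simp only [chartDomain, mem_ofPred_eq, Prod.smul_mk, Prod.mk_add_mk, smul_eq_mul] at *
  rcases ha.eq_or_lt with rfl | ha
  · obtain rfl : b = 1 := by linarith
    simpa using hy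
  · nlinarith [mul_pos ha hx, mul_nonneg hb hy.le]

theorem chartDomain_ne_zero {ε : ℝ} (q : chartDomain ε) : q.1.1 ≠ 0 := by
  intro h
  have : 0 < ε * q.1.1 := q.2
  simp [h] at this

theorem isPathConnected_pos {ε : ℝ} (hε : ε ≠ 0) : IsPathConnected {t : ℝ | 0 < ε * t} := by
  refine Convex.isPathConnected ?_ ⟨ε⁻¹, by simp [hε]⟩
  intro x hx y hy a b ha hb hab
  simp only [mem_ofPred_eq, smul_eq_mul] at *
  rcases ha.eq_or_lt with rfl | ha
  · obtain rfl : b = 1 := by linarith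
    simpa using hy
  · nlinarith [mul_pos ha hx, mul_nonneg hb hy.le]

theorem isPathConnected_chartDomain_two {ε : ℝ} (hε : ε ≠ 0) :
    IsPathConnected {q : ℝ × ℝ × ℝ × ℝ | 0 < ε * q.1 ∧ q.2.2 ≠ 0} := by
  have h2 : IsPathConnected ({0}ᶜ : Set (ℝ × ℝ)) :=
    isPathConnected_compl_singleton_of_one_lt_rank (by simp [← Module.finrank_eq_rank]) 0
  convert (isPathConnected_pos hε).prod ((isPathConnected_univ (X := ℝ)).prod h2) using 1
  ext q
  simp

theorem isPathConnected_chartDomain_three {ε : ℝ} (hε : ε ≠ 0) :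
    IsPathConnected {q : ℝ × ℝ × ℝ × ℝ | 0 < ε * q.1 ∧ q.2 ≠ 0} := by
  have h2 : IsPathConnected ({0}ᶜ : Set (ℝ × ℝ × ℝ)) :=
    isPathConnected_compl_singleton_of_one_lt_rank (by simp [← Module.finrank_eq_rank]) 0
  convert (isPathConnected_pos hε).prod h2 using 1
  ext q
  simp

theorem ne_zero_of_apply {p : Fin 7 → ℝ} (i : Fin 7) (h : p i ≠ 0) : p ≠ 0 := by
  rintro rfl; exact h rfl

/-- The chart of the cone where the coordinate `p 0` does not vanish. -/
noncomputable def chart₀ (ε : ℝ) (q : chartDomain ε) : Cone :=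
  ⟨![q.1.1, q.1.2.2.1, q.1.2.2.2, q.1.2.1, -q.1.2.2.1 * q.1.2.2.2 / q.1.1,
    -q.1.2.2.1 * q.1.2.1 / q.1.1,
    q.1.2.2.2 * (-q.1.2.2.1 * q.1.2.2.2 / q.1.1 - q.1.2.1) / q.1.1],
    ne_zero_of_apply 0 (chartDomain_ne_zero q), by
      have := chartDomain_ne_zero q
      constructor <;> simp only [Matrix.cons_val] <;> field_simp <;> ring⟩

/-- The chart of the cone where the coordinate `p 1` does not vanish. -/
noncomputable def chart₁ (ε : ℝ) (q : chartDomain ε) : Cone :=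
  ⟨![q.1.2.1, q.1.1, -q.1.2.1 * q.1.2.2.1 / q.1.1, -q.1.2.1 * q.1.2.2.2 / q.1.1, q.1.2.2.1,
    q.1.2.2.2, q.1.2.2.1 * (-q.1.2.1 * q.1.2.2.2 / q.1.1 - q.1.2.2.1) / q.1.1],
    ne_zero_of_apply 1 (chartDomain_ne_zero q), by
      have := chartDomain_ne_zero q
      constructor <;> simp only [Matrix.cons_val] <;> field_simp <;> ring⟩

/-- The chart of the cone where the coordinate `p 2` does not vanish. -/
noncomputable def chart₂ (ε : ℝ) (q : chartDomain ε) : Cone :=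
  ⟨![q.1.2.1, -q.1.2.1 * q.1.2.2.1 / q.1.1, q.1.1, q.1.2.2.1 - q.1.2.1 * q.1.2.2.2 / q.1.1,
    q.1.2.2.1, (q.1.2.2.1 - q.1.2.1 * q.1.2.2.2 / q.1.1) * q.1.2.2.1 / q.1.1, q.1.2.2.2],
    ne_zero_of_apply 2 (chartDomain_ne_zero q), by
      have := chartDomain_ne_zero q
      constructor <;> simp only [Matrix.cons_val] <;> field_simp <;> ring⟩

/-- The positive solution of `a - a⁻¹ = -m`. -/
noncomputable def posRoot (m : ℝ) : ℝ := (-m + √(m ^ 2 + 4)) / 2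

theorem continuous_posRoot : Continuous posRoot := by unfold posRoot; fun_prop

theorem posRoot_mul (m : ℝ) : posRoot m * posRoot (-m) = 1 := by
  have := Real.sq_sqrt (show 0 ≤ m ^ 2 + 4 by positivity)
  simp only [posRoot, neg_sq]
  linear_combination this / 4

theorem posRoot_sub (m : ℝ) : posRoot m - posRoot (-m) = -m := by
  simp only [posRoot, neg_sq]; ring

theorem posRoot_pos (m : ℝ) : 0 < posRoot m := by
  have : |m| < √(m ^ 2 + 4) := by
    rw [← Real.sqrt_sq_eq_abs]
    exact Real.sqrt_lt_sqrt (sq_nonneg m) (by linarith)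
  have := (abs_lt.1 this).2
  unfold posRoot; linarith

theorem posRoot_eq {a b : ℝ} (ha : 0 < a) (hb : 0 < b) (hab : a * b = 1) :
    posRoot (b - a) = a := by
  have : √((b - a) ^ 2 + 4) = a + b := by
    rw [show (b - a) ^ 2 + 4 = (a + b) ^ 2 by linear_combination -4 * hab]
    exact Real.sqrt_sq (by positivity)
  rw [posRoot, this]; ring

/-- The chart of the cone at the plane `𝔩_{α+β}`. -/
noncomputable def chart₃ (ε : ℝ) (q : chartDomain ε) : Cone :=
  ⟨![q.1.1 * q.1.2.1,
    -q.1.1 * q.1.2.1 * q.1.2.2.1 * posRoot (-(q.1.2.1 * q.1.2.2.1 * q.1.2.2.2)),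
    -q.1.1 * q.1.2.1 * q.1.2.2.2 * posRoot (q.1.2.1 * q.1.2.2.1 * q.1.2.2.2),
    q.1.1 * posRoot (q.1.2.1 * q.1.2.2.1 * q.1.2.2.2),
    -q.1.1 * (q.1.2.1 * q.1.2.2.1 * q.1.2.2.2), q.1.1 * q.1.2.2.1, q.1.1 * q.1.2.2.2],
    ne_zero_of_apply 3 (mul_ne_zero (chartDomain_ne_zero q) (posRoot_pos _).ne'), by
      obtain ⟨⟨k, x, y, z⟩, hq⟩ := q
      have h1 := posRoot_mul (x * y * z)
      have h2 := posRoot_sub (x * y * z)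
      constructor <;> simp only [Matrix.cons_val]
      · linear_combination k ^ 2 * x ^ 2 * y * z * h1
      · linear_combination -k ^ 2 * x * y * h1
      · linear_combination (-k ^ 2 * x * z) * h1 + k ^ 2 * x * z * posRoot (x * y * z) * (-h2)
      · ring
      · linear_combination k ^ 2 * (x * y * z) * h2⟩

theorem continuous_chart₀ (ε : ℝ) : Continuous (chart₀ ε) := by
  refine Continuous.subtype_mk (continuous_vec_seven ?_ ?_ ?_ ?_ ?_ ?_ ?_) _ <;>
  fun_prop (disch := exact chartDomain_ne_zero)

theorem continuous_chart₁ (ε : ℝ) : Continuous (chart₁ ε) := by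
  refine Continuous.subtype_mk (continuous_vec_seven ?_ ?_ ?_ ?_ ?_ ?_ ?_) _ <;>
  fun_prop (disch := exact chartDomain_ne_zero)

theorem continuous_chart₂ (ε : ℝ) : Continuous (chart₂ ε) := by
  refine Continuous.subtype_mk (continuous_vec_seven ?_ ?_ ?_ ?_ ?_ ?_ ?_) _ <;>
  fun_prop (disch := exact chartDomain_ne_zero)

theorem continuous_chart₃ (ε : ℝ) : Continuous (chart₃ ε) := by
  have := continuous_posRoot
  refine Continuous.subtype_mk (continuous_vec_seven ?_ ?_ ?_ ?_ ?_ ?_ ?_) _ <;>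
  fun_prop

theorem isOpen_pos_apply (ε : ℝ) (i : Fin 7) : IsOpen {p : Cone | 0 < ε * p.1 i} :=
  isOpen_lt continuous_const (continuous_const.mul (continuous_cone_apply i))

theorem apply_ne_zero_of_pos {ε : ℝ} {i : Fin 7} (p : {p : Cone | 0 < ε * p.1 i}) :
    p.1.1 i ≠ 0 := by
  intro h
  have : 0 < ε * p.1.1 i := p.2
  simp [h] at this

theorem continuous_chartCoord {V : Set Cone} (i j k l : Fin 7) :
    Continuous fun p : V => (p.1.1 i, p.1.1 j, p.1.1 k, p.1.1 l) := by
  have hc (i : Fin 7) : Continuous fun p : V => p.1.1 i :=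
    (continuous_cone_apply i).comp continuous_subtype_val
  exact (hc i).prodMk ((hc j).prodMk ((hc k).prodMk (hc l)))

/-- Where p 0 ≠ 0 the relations `r0`, `r1`, `r2` determine p 4, p 5, p 6, so the chart is a
half-line times ℝ³. By `h` the set W fills the part where p 1 and p 2 do not both vanish: a
half-line times ℝ times a punctured plane. -/
theorem pathsPushInto_zero {ε : ℝ} (hε : ε ≠ 0) {W : Set Cone} (hW : IsOpen W)
    (h : ∀ p : Cone, 0 < ε * p.1 0 → (p ∈ W ↔ p.1 1 ≠ 0 ∨ p.1 2 ≠ 0)) :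
    PathsPushInto W (W ∪ {p : Cone | 0 < ε * p.1 0}) := by
  refine pathsPushInto_of_chart hW (isOpen_pos_apply ε 0) (convex_chartDomain ε)
    (isPathConnected_chartDomain_two hε)
    (s := fun p => ⟨(p.1.1 0, p.1.1 3, p.1.1 1, p.1.1 2), p.2⟩) (r := chart₀ ε)
    ((continuous_chartCoord _ _ _ _).subtype_mk _) (continuous_chart₀ ε) ?_ (fun q hq => hq.1) ?_ ?_
  · intro p
    have h0 := apply_ne_zero_of_pos p
    obtain ⟨r0, r1, r2, r3, r4⟩ := p.1.2.2
    apply Subtype.ext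
    ext i
    fin_cases i <;> simp [chart₀] <;> field_simp
    · linear_combination -r0
    · linear_combination -r1
    · linear_combination (-p.1.1 0) * r2 - p.1.1 2 * r0
  · intro p hp
    refine ⟨p.2, ?_⟩
    have := (h p.1 p.2).1 hp
    simpa [Prod.ext_iff, imp_iff_not_or] using this
  · intro q hq
    have h1 : 0 < ε * (chart₀ ε q).1 0 := q.2
    refine ⟨(h _ h1).2 ?_, h1⟩
    have := hq.2
    simpa [Prod.ext_iff, imp_iff_not_or, chart₀] using this

/-- Here p 2, p 3 and p 6 are determined by the relations, and W is the part where p 4 and p 5 do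
not both vanish. -/
theorem pathsPushInto_one {ε : ℝ} (hε : ε ≠ 0) {W : Set Cone} (hW : IsOpen W)
    (h : ∀ p : Cone, 0 < ε * p.1 1 → (p ∈ W ↔ p.1 4 ≠ 0 ∨ p.1 5 ≠ 0)) :
    PathsPushInto W (W ∪ {p : Cone | 0 < ε * p.1 1}) := by
  refine pathsPushInto_of_chart hW (isOpen_pos_apply ε 1) (convex_chartDomain ε)
    (isPathConnected_chartDomain_two hε)
    (s := fun p => ⟨(p.1.1 1, p.1.1 0, p.1.1 4, p.1.1 5), p.2⟩) (r := chart₁ ε)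
    ((continuous_chartCoord _ _ _ _).subtype_mk _) (continuous_chart₁ ε) ?_ (fun q hq => hq.1) ?_ ?_
  · intro p
    have h0 := apply_ne_zero_of_pos p
    obtain ⟨r0, r1, r2, r3, r4⟩ := p.1.2.2
    apply Subtype.ext
    ext i
    fin_cases i <;> simp [chart₁] <;> field_simp
    · linear_combination -r0
    · linear_combination -r1
    · linear_combination (-p.1.1 1) * r4 - p.1.1 4 * r1 + p.1.1 1 * r3
  · intro p hp
    refine ⟨p.2, ?_⟩
    have := (h p.1 p.2).1 hp
    simpa [Prod.ext_iff, imp_iff_not_or] using this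
  · intro q hq
    have h1 : 0 < ε * (chart₁ ε q).1 1 := q.2
    refine ⟨(h _ h1).2 ?_, h1⟩
    have := hq.2
    simpa [Prod.ext_iff, imp_iff_not_or, chart₁] using this

/-- Here p 1, p 3 and p 5 are determined by the relations, and W is the part where p 4 and p 6 do
not both vanish. -/
theorem pathsPushInto_two {ε : ℝ} (hε : ε ≠ 0) {W : Set Cone} (hW : IsOpen W)
    (h : ∀ p : Cone, 0 < ε * p.1 2 → (p ∈ W ↔ p.1 4 ≠ 0 ∨ p.1 6 ≠ 0)) :
    PathsPushInto W (W ∪ {p : Cone | 0 < ε * p.1 2}) := by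
  refine pathsPushInto_of_chart hW (isOpen_pos_apply ε 2) (convex_chartDomain ε)
    (isPathConnected_chartDomain_two hε)
    (s := fun p => ⟨(p.1.1 2, p.1.1 0, p.1.1 4, p.1.1 6), p.2⟩) (r := chart₂ ε)
    ((continuous_chartCoord _ _ _ _).subtype_mk _) (continuous_chart₂ ε) ?_ (fun q hq => hq.1) ?_ ?_
  · intro p
    have h0 := apply_ne_zero_of_pos p
    obtain ⟨r0, r1, r2, r3, r4⟩ := p.1.2.2
    apply Subtype.ext
    ext i
    fin_cases i <;> simp [chart₂] <;> field_simp
    · linear_combination -r0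
    · linear_combination -r2
    · linear_combination p.1.1 2 * r3 - p.1.1 4 * r2
  · intro p hp
    refine ⟨p.2, ?_⟩
    have := (h p.1 p.2).1 hp
    simpa [Prod.ext_iff, imp_iff_not_or] using this
  · intro q hq
    have h1 : 0 < ε * (chart₂ ε q).1 2 := q.2
    refine ⟨(h _ h1).2 ?_, h1⟩
    have := hq.2
    simpa [Prod.ext_iff, imp_iff_not_or, chart₂] using this

theorem isOpen_pos_chart₃ (ε : ℝ) :
    IsOpen {p : Cone | 0 < ε * p.1 3 ∧ 0 < ε * (p.1 3 - p.1 4)} :=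
  (isOpen_pos_apply ε 3).inter (isOpen_lt continuous_const
    (continuous_const.mul ((continuous_cone_apply 3).sub (continuous_cone_apply 4))))

/-- Eliminating p 1 and p 2 leaves p 3 p 4 (p 3 - p 4) = - p 0 p 5 p 6, which is quadratic in p 4.
Normalising by k with k² = p 3 (p 3 - p 4), the numbers a = p 3 / k and b = (p 3 - p 4) / k are
positive with a b = 1, and b - a is the product of p 0 / k, p 5 / k, p 6 / k. So `posRoot` recovers
a and b, and the chart is again a half-line times ℝ³; W omits only a half-line. -/
theorem pathsPushInto_three {ε : ℝ} (hε : ε ^ 2 = 1) {W : Set Cone} (hW : IsOpen W)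
    (h : ∀ p : Cone, 0 < ε * p.1 3 ∧ 0 < ε * (p.1 3 - p.1 4) →
      (p ∈ W ↔ p.1 0 ≠ 0 ∨ p.1 5 ≠ 0 ∨ p.1 6 ≠ 0)) :
    PathsPushInto W (W ∪ {p : Cone | 0 < ε * p.1 3 ∧ 0 < ε * (p.1 3 - p.1 4)}) := by
  set V := {p : Cone | 0 < ε * p.1 3 ∧ 0 < ε * (p.1 3 - p.1 4)} with hV
  have hε0 : ε ≠ 0 := by rintro rfl; norm_num at hε
  have hpos (p : V) : 0 < p.1.1 3 * (p.1.1 3 - p.1.1 4) := by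
    have := mul_pos p.2.1 p.2.2
    calc _ < _ := this
      _ = ε ^ 2 * (p.1.1 3 * (p.1.1 3 - p.1.1 4)) := by ring
      _ = _ := by rw [hε, one_mul]
  let k (p : V) : ℝ := ε * √(p.1.1 3 * (p.1.1 3 - p.1.1 4))
  have hkε (p : V) : 0 < ε * k p := by
    have : ε * k p = ε ^ 2 * √(p.1.1 3 * (p.1.1 3 - p.1.1 4)) := by simp only [k]; ring
    rw [this, hε, one_mul]
    exact Real.sqrt_pos.2 (hpos p)
  have hk0 (p : V) : k p ≠ 0 := fun h => by have := hkε p; simp [h] at this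
  have hk2 (p : V) : k p ^ 2 = p.1.1 3 * (p.1.1 3 - p.1.1 4) := by
    simp only [k]
    rw [mul_pow, hε, one_mul, Real.sq_sqrt (hpos p).le]
  have hc (i : Fin 7) : Continuous fun p : V => p.1.1 i :=
    (continuous_cone_apply i).comp continuous_subtype_val
  have hkc : Continuous k :=
    continuous_const.mul (((hc 3).mul ((hc 3).sub (hc 4))).sqrt)
  refine pathsPushInto_of_chart hW (isOpen_pos_chart₃ ε) (convex_chartDomain ε)
    (isPathConnected_chartDomain_three hε0)
    (s := fun p => ⟨(k p, p.1.1 0 / k p, p.1.1 5 / k p, p.1.1 6 / k p), hkε p⟩) (r := chart₃ ε)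
    (Continuous.subtype_mk (hkc.prodMk (((hc 0).div hkc hk0).prodMk
      (((hc 5).div hkc hk0).prodMk ((hc 6).div hkc hk0)))) _)
    (continuous_chart₃ ε) ?_ (fun q hq => hq.1) ?_ ?_
  · intro p
    have h0 := hk0 p
    have h2 := hk2 p
    have hsg (x : ℝ) (hx : 0 < ε * x) : 0 < x / k p := by
      have := div_pos hx (hkε p)
      rwa [mul_div_mul_left _ _ hε0] at this
    have ha := hsg _ p.2.1
    have hb := hsg _ p.2.2
    have hab : p.1.1 3 / k p * ((p.1.1 3 - p.1.1 4) / k p) = 1 := by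
      field_simp; exact h2.symm
    obtain ⟨r0, r1, r2, r3, r4⟩ := p.1.2.2
    have hm : p.1.1 0 / k p * (p.1.1 5 / k p) * (p.1.1 6 / k p) =
        (p.1.1 3 - p.1.1 4) / k p - p.1.1 3 / k p := by
      field_simp
      rw [h2]
      linear_combination (p.1.1 3 - p.1.1 4) * r3 + p.1.1 5 * r2
    have hA : posRoot (p.1.1 0 / k p * (p.1.1 5 / k p) * (p.1.1 6 / k p)) = p.1.1 3 / k p := by
      rw [hm]; exact posRoot_eq ha hb hab
    have hB : posRoot (-(p.1.1 0 / k p * (p.1.1 5 / k p) * (p.1.1 6 / k p))) =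
        (p.1.1 3 - p.1.1 4) / k p := by
      rw [hm, neg_sub]; exact posRoot_eq hb ha (by rw [mul_comm]; exact hab)
    have h3 : p.1.1 3 ≠ 0 := fun h => by have := p.2.1; simp [h] at this
    have h34 : p.1.1 3 - p.1.1 4 ≠ 0 := fun h => by have := p.2.2; simp [h] at this
    apply Subtype.ext
    ext i
    fin_cases i <;> simp only [chart₃, hA, hB] <;> simp only [hm] <;> simp <;> field_simp
    · rw [h2]
      linear_combination (-(p.1.1 3 - p.1.1 4)) * r1
    · rw [h2]
      linear_combination (-p.1.1 3) * r2
    · ring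
  · intro p hp
    refine ⟨hkε p, ?_⟩
    have := (h p.1 p.2).1 hp
    have h0 := hk0 p
    simp only [ne_eq, Prod.ext_iff, Prod.fst_zero, Prod.snd_zero, div_eq_zero_iff, h0, or_false]
    tauto
  · intro q hq
    have h0 := chartDomain_ne_zero q
    have hqε : 0 < ε * q.1.1 := q.2
    have h1 : chart₃ ε q ∈ V := by
      constructor
      · simp only [chart₃, Matrix.cons_val]
        rw [← mul_assoc]
        exact mul_pos hqε (posRoot_pos _)
      · have := mul_pos hqε (posRoot_pos (-(q.1.2.1 * q.1.2.2.1 * q.1.2.2.2)))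
        have h2 := posRoot_sub (q.1.2.1 * q.1.2.2.1 * q.1.2.2.2)
        simp only [chart₃, Matrix.cons_val]
        calc _ < _ := this
          _ = _ := by linear_combination ε * q.1.1 * (-h2)
    refine ⟨(h _ h1).2 ?_, h1⟩
    have := hq.2
    simp only [ne_eq, Prod.ext_iff, Prod.fst_zero, Prod.snd_zero] at this
    simp only [chart₃, Matrix.cons_val, ne_eq, mul_eq_zero, h0, false_or]
    tauto

/-- This and the next three lemmas express what is already covered, inside a new chart, by chart
coordinates. Here `r4` alone suffices: p 5 = p 6 = 0 forces p 4 = 0, and p 4 = p 5 = 0 forces p 6 =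
0. -/
theorem PluckerRel.iff_one {p : Fin 7 → ℝ} (hp : PluckerRel p) (h : p 1 ≠ 0) :
    (p 5 ≠ 0 ∨ p 6 ≠ 0) ↔ (p 4 ≠ 0 ∨ p 5 ≠ 0) := by
  obtain ⟨r0, r1, r2, r3, r4⟩ := hp
  grind

theorem PluckerRel.iff_two {p : Fin 7 → ℝ} (hp : PluckerRel p) (h : p 2 ≠ 0) :
    ((p 5 ≠ 0 ∨ p 6 ≠ 0) ∨ p 1 ≠ 0) ↔ (p 4 ≠ 0 ∨ p 6 ≠ 0) := by
  obtain ⟨r0, r1, r2, r3, r4⟩ := hp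
  grind

theorem PluckerRel.iff_zero {p : Fin 7 → ℝ} (hp : PluckerRel p) (h : p 0 ≠ 0) :
    (((p 5 ≠ 0 ∨ p 6 ≠ 0) ∨ p 1 ≠ 0) ∨ p 2 ≠ 0) ↔ (p 1 ≠ 0 ∨ p 2 ≠ 0) := by
  obtain ⟨r0, r1, r2, r3, r4⟩ := hp
  grind

theorem PluckerRel.iff_three {p : Fin 7 → ℝ} (hp : PluckerRel p) (h : p 3 ≠ 0)
    (h' : p 3 - p 4 ≠ 0) :
    ((((p 5 ≠ 0 ∨ p 6 ≠ 0) ∨ p 1 ≠ 0) ∨ p 2 ≠ 0) ∨ p 0 ≠ 0) ↔ (p 0 ≠ 0 ∨ p 5 ≠ 0 ∨ p 6 ≠ 0) := by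
  obtain ⟨r0, r1, r2, r3, r4⟩ := hp
  have h1 : p 0 = 0 → p 1 = 0 := fun h0 => by
    rw [h0] at r1; simpa [h] using r1
  have h2 : p 0 = 0 → p 2 = 0 := fun h0 => by
    have : p 2 * (p 3 - p 4) = 0 := by rw [h0] at r2; linear_combination r2
    simpa [h'] using this
  tauto

theorem or_pos_or_neg_iff (a : Prop) (x : ℝ) :
    ((a ∨ 0 < 1 * x) ∨ 0 < -1 * x) ↔ (a ∨ x ≠ 0) := by
  rw [or_assoc, one_mul, neg_one_mul, neg_pos, or_comm (b := x < 0), ← ne_iff_lt_or_gt]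

/-- The charts are added in the order p 1, p 2, p 0, p 3, each as two disjoint halves by sign. In
this order the part of a new chart not yet covered has codimension two or three, so that the covered
part is path connected. -/
theorem pathsPushInto_univ :
    PathsPushInto {p : Cone | p.1 5 ≠ 0 ∨ p.1 6 ≠ 0} (univ : Set Cone) := by
  have hUo : IsOpen {p : Cone | p.1 5 ≠ 0 ∨ p.1 6 ≠ 0} := by
    have h (i : Fin 7) : IsOpen {p : Cone | p.1 i ≠ 0} :=
      isOpen_ne_fun (continuous_cone_apply i) continuous_const
    exact (h 5).union (h 6)
  have hne (ε x : ℝ) (h : 0 < ε * x) : x ≠ 0 := by rintro rfl; simp at h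
  have hnot (x : ℝ) (h : 0 < -1 * x) : ¬ 0 < 1 * x := by linarith
  have s1 := pathsPushInto_one (ε := 1) (by norm_num) hUo
    (fun p h => p.2.2.iff_one (hne _ _ h))
  have o1 := hUo.union (isOpen_pos_apply 1 1)
  have s2 := pathsPushInto_one (ε := -1) (by norm_num) o1
    (fun p h => (or_iff_left (hnot _ h)).trans (p.2.2.iff_one (hne _ _ h)))
  have o2 := o1.union (isOpen_pos_apply (-1) 1)
  have m2 (p : Cone) := or_pos_or_neg_iff (p.1 5 ≠ 0 ∨ p.1 6 ≠ 0) (p.1 1)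
  have s3 := pathsPushInto_two (ε := 1) (by norm_num) o2
    (fun p h => (m2 p).trans (p.2.2.iff_two (hne _ _ h)))
  have o3 := o2.union (isOpen_pos_apply 1 2)
  have s4 := pathsPushInto_two (ε := -1) (by norm_num) o3
    (fun p h => (or_iff_left (hnot _ h)).trans ((m2 p).trans (p.2.2.iff_two (hne _ _ h))))
  have o4 := o3.union (isOpen_pos_apply (-1) 2)
  have m4 (p : Cone) := (or_pos_or_neg_iff _ (p.1 2)).trans (or_congr_left (m2 p))
  have s5 := pathsPushInto_zero (ε := 1) (by norm_num) o4
    (fun p h => (m4 p).trans (p.2.2.iff_zero (hne _ _ h)))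
  have o5 := o4.union (isOpen_pos_apply 1 0)
  have s6 := pathsPushInto_zero (ε := -1) (by norm_num) o5
    (fun p h => (or_iff_left (hnot _ h)).trans ((m4 p).trans (p.2.2.iff_zero (hne _ _ h))))
  have o6 := o5.union (isOpen_pos_apply (-1) 0)
  have m6 (p : Cone) := (or_pos_or_neg_iff _ (p.1 0)).trans (or_congr_left (m4 p))
  have s7 := pathsPushInto_three (ε := 1) (by norm_num) o6
    (fun p h => (m6 p).trans (p.2.2.iff_three (hne _ _ h.1) (hne _ _ h.2)))
  have o7 := o6.union (isOpen_pos_chart₃ 1)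
  have s8 := pathsPushInto_three (ε := -1) (by norm_num) o7
    (fun p h => (or_iff_left fun h' => hnot _ h.1 h'.1).trans
      ((m6 p).trans (p.2.2.iff_three (hne _ _ h.1) (hne _ _ h.2))))
  refine s1.trans subset_union_left (s2.trans subset_union_left (s3.trans subset_union_left
    (s4.trans subset_union_left (s5.trans subset_union_left (s6.trans subset_union_left
      (s7.trans subset_union_left ?_))))))
  convert s8 using 1
  refine (eq_univ_of_forall fun p => ?_).symm
  by_contra hp
  have hp6 := mt (fun h => Or.inl (Or.inl ((m6 p).2 h))) hp
  have hp7 := mt (fun h => Or.inl (Or.inr h)) hp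
  have hp8 := mt Or.inr hp
  clear hp
  obtain ⟨p, p0, r0, r1, r2, r3, r4⟩ := p
  simp only [not_or, not_not] at hp6
  obtain ⟨⟨⟨⟨h5, h6⟩, h1⟩, h2⟩, h0⟩ := hp6
  -- Outside the other charts `r4` reduces to p 4² = 0. Only p 3 can survive, and the last two
  -- charts catch both of its signs.
  have h4 : p 4 = 0 := by
    rw [h1, h2] at r4
    have : p 4 * p 4 = 0 := by linarith
    simpa using this
  change ¬ (0 < 1 * p 3 ∧ 0 < 1 * (p 3 - p 4)) at hp7
  change ¬ (0 < -1 * p 3 ∧ 0 < -1 * (p 3 - p 4)) at hp8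
  rw [h4, sub_zero, and_self] at hp7 hp8
  have h3 : p 3 = 0 := by linarith
  apply p0
  ext i
  fin_cases i <;> assumption

/-! ### Contraction onto the projective line and simple connectedness -/

/-- The vectors of coordinates of the planes that contain `E₁₃`. -/
def projVec (h x y : ℝ) : Fin 7 → ℝ := ![0, 0, 0, h, 0, x, y]

theorem pluckerRel_projVec (h x y : ℝ) : PluckerRel (projVec h x y) := by
  constructor <;> simp [projVec]

theorem continuous_projVec {X : Type*} [TopologicalSpace X] {h x y : X → ℝ} (hh : Continuous h)
    (hx : Continuous x) (hy : Continuous y) :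
    Continuous fun z => projVec (h z) (x z) (y z) :=
  continuous_vec_seven continuous_const continuous_const continuous_const hh continuous_const
    hx hy

theorem projVec_eq_zero {h x y : ℝ} : projVec h x y = 0 ↔ h = 0 ∧ x = 0 ∧ y = 0 := by
  constructor
  · intro H
    exact ⟨congrFun H 3, congrFun H 5, congrFun H 6⟩
  · rintro ⟨rfl, rfl, rfl⟩
    ext i; fin_cases i <;> rfl

theorem eq_projVec {p : Fin 7 → ℝ} (h0 : p 0 = 0) (h1 : p 1 = 0) (h2 : p 2 = 0) (h4 : p 4 = 0) :
    p = projVec (p 3) (p 5) (p 6) := by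
  ext i; fin_cases i <;> simp [projVec, h0, h1, h2, h4]

/-- The one-parameter group that contracts a neighbourhood of the projective line onto it. -/
def flow (t : ℝ) (p : Fin 7 → ℝ) : Fin 7 → ℝ :=
  ![t ^ 3 * p 0, t ^ 2 * p 1, t ^ 2 * p 2, t * p 3, t * p 4, p 5, p 6]

/-- The exponent of t is 3 minus the height of the minor, where E₁₂ and E₂₃ have height 1, E₁₃ has
height 2 and diagonal coordinates have height 0. Each relation is homogeneous for this grading. -/
theorem PluckerRel.flow {p : Fin 7 → ℝ} (hp : PluckerRel p) (t : ℝ) :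
    PluckerRel (SL3.flow t p) := by
  obtain ⟨r0, r1, r2, r3, r4⟩ := hp
  constructor <;> simp only [SL3.flow, Matrix.cons_val]
  · linear_combination t ^ 4 * r0
  · linear_combination t ^ 3 * r1
  · linear_combination t ^ 3 * r2
  · linear_combination t ^ 2 * r3
  · linear_combination t ^ 2 * r4

theorem flow_one (p : Fin 7 → ℝ) : flow 1 p = p := by
  ext i; fin_cases i <;> simp [flow]

theorem flow_zero (p : Fin 7 → ℝ) : flow 0 p = projVec 0 (p 5) (p 6) := by
  ext i; fin_cases i <;> simp [flow, projVec]

theorem flow_projVec_zero (t x y : ℝ) : flow t (projVec 0 x y) = projVec 0 x y := by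
  ext i; fin_cases i <;> simp [flow, projVec]

theorem flow_ne_zero {p : Fin 7 → ℝ} (h : p 5 ≠ 0 ∨ p 6 ≠ 0) (t : ℝ) : flow t p ≠ 0 := by
  rcases h with h | h
  · exact ne_zero_of_apply 5 h
  · exact ne_zero_of_apply 6 h

/-- The planes containing `E₁₃`, with a choice of coordinates for which the coefficient of
`𝔩_{α+β}` is not negative. -/
theorem pathsHomotopicIn_projVec :
    PathsHomotopicIn {p : Cone | p.1 0 = 0 ∧ p.1 1 = 0 ∧ p.1 2 = 0 ∧ p.1 4 = 0 ∧ 0 ≤ p.1 3} := by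
  let K : Set (ℝ × ℝ × ℝ) := {q | 0 ≤ q.1 ∧ q ≠ 0}
  -- A closed half-space without the origin is star-shaped about an interior point, hence
  -- contractible, although its boundary is a punctured plane.
  have hK : StarConvex ℝ (1, 0, 0) K := by
    rintro ⟨h, x, y⟩ ⟨hh, hne⟩ a b ha hb hab
    simp only at hh
    refine ⟨by simp; positivity, fun h0 => ?_⟩
    simp [Prod.ext_iff] at h0
    have hbh := mul_nonneg hb hh
    obtain ⟨h1, h2, h3⟩ := h0
    have ha0 : a = 0 := by linarith
    have hb1 : b = 1 := by linarith
    subst ha0 hb1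
    simp at h1 h2 h3
    exact hne (by simp [h1, h2, h3])
  have : ContractibleSpace K := hK.contractibleSpace ⟨(1, 0, 0), by simp [K]⟩
  have hc := continuous_cone_apply
  refine pathsHomotopicIn_of_simplyConnected (K := K)
    (s := fun p => ⟨(p.1.1 3, p.1.1 5, p.1.1 6), p.2.2.2.2.2, fun h => ?_⟩)
    (r := fun q => ⟨projVec q.1.1 q.1.2.1 q.1.2.2, fun h => q.2.2 ?_, pluckerRel_projVec _ _ _⟩)
    ?_ ?_ ?_
  · obtain ⟨h0, h1, h2, h4, -⟩ := p.2
    apply p.1.2.1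
    rw [eq_projVec h0 h1 h2 h4]
    simp [Prod.ext_iff] at h
    exact projVec_eq_zero.2 h
  · have := projVec_eq_zero.1 h
    simp [Prod.ext_iff, this]
  · have hc (i : Fin 7) : Continuous fun p : {p : Cone | p.1 0 = 0 ∧ p.1 1 = 0 ∧ p.1 2 = 0 ∧
        p.1 4 = 0 ∧ 0 ≤ p.1 3} => p.1.1 i :=
      (continuous_cone_apply i).comp continuous_subtype_val
    exact ((hc 3).prodMk ((hc 5).prodMk (hc 6))).subtype_mk _
  · exact (continuous_projVec (by fun_prop) (by fun_prop) (by fun_prop)).subtype_mk _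
  · rintro ⟨p, h0, h1, h2, h4, h3⟩
    exact Subtype.ext (eq_projVec h0 h1 h2 h4).symm

theorem continuous_flow {X : Type*} [TopologicalSpace X] {t : X → ℝ} {p : X → Fin 7 → ℝ}
    (ht : Continuous t) (hp : Continuous p) : Continuous fun x => flow (t x) (p x) := by
  have h (i : Fin 7) : Continuous fun x => p x i := (continuous_apply i).comp hp
  exact continuous_vec_seven ((ht.pow 3).mul (h 0)) ((ht.pow 2).mul (h 1)) ((ht.pow 2).mul (h 2))
    (ht.mul (h 3)) (ht.mul (h 4)) (h 5) (h 6)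

/-- A point of the cone over the projective line. -/
def projPoint (h x y : ℝ) (hxy : (h, x, y) ≠ 0) : Cone :=
  ⟨projVec h x y, fun h => hxy (by have := projVec_eq_zero.1 h; simp [Prod.ext_iff, this]),
    pluckerRel_projVec _ _ _⟩

/-- A loop pushed into the set where p 5 or p 6 is nonzero flows, as t goes from 1 to 0, into the
punctured plane over ℙ¹(ℝ). The base point lies there and is fixed by the flow. In the half-space of
`pathsHomotopicIn_projVec` the resulting loop is homotopic to the constant one. -/
instance : SimplyConnectedSpace Cone := by
  have hb0 : ((0 : ℝ), (1 : ℝ), (0 : ℝ)) ≠ 0 := by simp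
  let b : Cone := projPoint 0 1 0 hb0
  refine simplyConnectedSpace_of_loops b (fun p => ?_) (fun γ => ?_)
  · obtain ⟨q, hq, hpq⟩ := pathsPushInto_univ.points p (mem_univ p)
    refine hpq.trans ?_
    have hne : ((q.1 5, q.1 6) : ℝ × ℝ) ≠ 0 := by
      rcases hq with h | h <;> simp [Prod.ext_iff, h]
    have hflow : Joined q (projPoint 0 (q.1 5) (q.1 6)
        (by rcases hq with h | h <;> simp [Prod.ext_iff, h])) := by
      refine ⟨⟨⟨fun t => ⟨flow (1 - t) q.1, flow_ne_zero hq _, q.2.2.flow _⟩, ?_⟩, ?_, ?_⟩⟩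
      · exact (continuous_flow (by fun_prop) continuous_const).subtype_mk _
      · exact Subtype.ext (by simp [flow_one])
      · exact Subtype.ext (by simp [flow_zero, projPoint])
    refine hflow.trans ?_
    have h2 : IsPathConnected ({0}ᶜ : Set (ℝ × ℝ)) :=
      isPathConnected_compl_singleton_of_one_lt_rank (by simp [← Module.finrank_eq_rank]) 0
    obtain ⟨δ, hδ⟩ := h2.joinedIn (q.1 5, q.1 6) hne (1, 0) (by simp)
    refine ⟨⟨⟨fun t => projPoint 0 (δ t).1 (δ t).2 ?_, ?_⟩, ?_, ?_⟩⟩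
    · intro h
      apply hδ t
      simpa [Prod.ext_iff] using h
    · exact (continuous_projVec (by fun_prop) (by fun_prop) (by fun_prop)).subtype_mk _
    · simp
    · simp [b]
  · have hbU : b ∈ {p : Cone | p.1 5 ≠ 0 ∨ p.1 6 ≠ 0} := Or.inl (by simp [b, projPoint, projVec])
    obtain ⟨γ', hγ', hh⟩ := pathsPushInto_univ.paths γ hbU hbU (subset_univ _)
    refine hh.trans ?_
    have hU (t) : (γ' t).1 5 ≠ 0 ∨ (γ' t).1 6 ≠ 0 := hγ' (mem_range_self t)
    have hcont : Continuous fun t => (γ' t).1 := continuous_subtype_val.comp γ'.continuous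
    have hci (i : Fin 7) : Continuous fun t => (γ' t).1 i := (continuous_apply i).comp hcont
    let δ : Path b b :=
      { toFun := fun t => projPoint 0 ((γ' t).1 5) ((γ' t).1 6)
          (by rcases hU t with h | h <;> simp [Prod.ext_iff, h])
        continuous_toFun := (continuous_projVec continuous_const (hci 5) (hci 6)).subtype_mk _
        source' := by simp only [γ'.source]; rfl
        target' := by simp only [γ'.target]; rfl }
    have hδ : γ'.Homotopic δ := by
      refine ⟨⟨⟨⟨fun q => ⟨flow (1 - q.1) (γ' q.2).1, flow_ne_zero (hU _) _,
        (γ' q.2).2.2.flow _⟩, ?_⟩, ?_, ?_⟩, ?_⟩⟩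
      · exact (continuous_flow (by fun_prop) (hcont.comp continuous_snd)).subtype_mk _
      · intro t
        exact Subtype.ext (by simp [flow_one])
      · intro t
        exact Subtype.ext ((congrArg (flow · (γ' t).1) (sub_self 1)).trans (flow_zero _))
      · rintro t x (rfl | rfl) <;> apply Subtype.ext
        · change flow (1 - t) (γ' 0).1 = (γ' 0).1
          rw [γ'.source]; exact flow_projVec_zero _ _ _
        · change flow (1 - t) (γ' 1).1 = (γ' 1).1
          rw [γ'.target]; exact flow_projVec_zero _ _ _
    refine hδ.trans (pathsHomotopicIn_projVec _ _ ?_ ?_)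
    · rintro _ ⟨t, rfl⟩
      exact ⟨rfl, rfl, rfl, rfl, le_rfl⟩
    · rintro _ ⟨t, rfl⟩
      exact ⟨rfl, rfl, rfl, rfl, le_rfl⟩

/-! ### The double cover of `Y` by the unit vectors of Plücker coordinates -/

/-- The unit vectors of Plücker coordinates of abelian planes. -/
def UnitCone : Type := {p : Fin 7 → ℝ // ∑ i, p i ^ 2 = 1 ∧ PluckerRel p}

instance : TopologicalSpace UnitCone := instTopologicalSpaceSubtype

instance : T2Space UnitCone := inferInstanceAs (T2Space (Subtype _))

theorem sum_sq_pos {p : Fin 7 → ℝ} (hp : p ≠ 0) : 0 < ∑ i, p i ^ 2 := by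
  obtain ⟨i, hi⟩ := Function.ne_iff.1 hp
  exact Finset.sum_pos' (fun _ _ => sq_nonneg _) ⟨i, Finset.mem_univ i, by
    have : p i ≠ 0 := hi
    positivity⟩

instance : CompactSpace UnitCone := by
  apply isCompact_iff_compactSpace.1
  have hK : IsCompact (Set.pi univ fun _ : Fin 7 => Icc (-1 : ℝ) 1) :=
    isCompact_univ_pi fun _ => isCompact_Icc
  refine hK.of_isClosed_subset ?_ ?_
  · have h1 : IsClosed {p : Fin 7 → ℝ | ∑ i, p i ^ 2 = 1} :=
      isClosed_eq (by fun_prop) continuous_const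
    have h2 : IsClosed {p : Fin 7 → ℝ | PluckerRel p} := by
      have : {p : Fin 7 → ℝ | PluckerRel p} = {p : Fin 7 → ℝ | p 0 * p 4 + p 1 * p 2 = 0} ∩
          {p : Fin 7 → ℝ | p 0 * p 5 + p 1 * p 3 = 0} ∩
          {p : Fin 7 → ℝ | p 0 * p 6 - p 2 * p 4 + p 2 * p 3 = 0} ∩
          {p : Fin 7 → ℝ | p 3 * p 4 - p 2 * p 5 = 0} ∩
          {p : Fin 7 → ℝ | p 1 * p 6 - p 2 * p 5 + p 4 * p 4 = 0} := by
        ext p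
        exact ⟨fun h => ⟨⟨⟨⟨h.r0, h.r1⟩, h.r2⟩, h.r3⟩, h.r4⟩,
          fun h => ⟨h.1.1.1.1, h.1.1.1.2, h.1.1.2, h.1.2, h.2⟩⟩
      rw [this]
      refine (((IsClosed.inter ?_ ?_).inter ?_).inter ?_).inter ?_ <;>
      exact isClosed_eq (by fun_prop) continuous_const
    exact h1.inter h2
  · rintro p ⟨hp, -⟩ i -
    have : p i ^ 2 ≤ 1 := by
      rw [← hp]
      exact Finset.single_le_sum (f := fun i => p i ^ 2) (fun _ _ => sq_nonneg _)
        (Finset.mem_univ i)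
    exact abs_le.1 ((sq_le_one_iff_abs_le_one _).1 this)

/-- Unit vectors are nonzero. -/
def UnitCone.toCone (u : UnitCone) : Cone :=
  ⟨u.1, by rintro h; have := u.2.1; simp [h] at this, u.2.2⟩

theorem UnitCone.continuous_toCone : Continuous UnitCone.toCone :=
  continuous_subtype_val.subtype_mk _

/-- Normalisation of a nonzero vector. -/
noncomputable def Cone.normalize (p : Cone) : UnitCone :=
  ⟨(√(∑ i, p.1 i ^ 2))⁻¹ • p.1, by
    have := sum_sq_pos p.2.1
    simp only [Pi.smul_apply, smul_eq_mul, mul_pow, ← Finset.mul_sum, inv_pow,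
      Real.sq_sqrt this.le]
    exact inv_mul_cancel₀ this.ne', p.2.2.smul _⟩

theorem Cone.continuous_normalize : Continuous Cone.normalize := by
  have hc := continuous_cone_apply
  refine Continuous.subtype_mk (Continuous.smul (Continuous.inv₀ (Continuous.sqrt
    (continuous_finsetSum _ fun i _ => (hc i).pow 2)) fun p => ?_) continuous_subtype_val) _
  exact (Real.sqrt_pos.2 (sum_sq_pos p.2.1)).ne'

theorem UnitCone.normalize_toCone (u : UnitCone) : u.toCone.normalize = u := by
  apply Subtype.ext
  simp only [Cone.normalize, UnitCone.toCone, u.2.1]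
  simp

/-- Normalisation is a retraction of `Cone`, so homotopies of paths found there can be pushed back
to the unit vectors. -/
instance : SimplyConnectedSpace UnitCone := by
  have h : PathsHomotopicIn (univ : Set UnitCone) :=
    pathsHomotopicIn_of_simplyConnected (K := Cone) (s := fun u => u.1.toCone)
      (r := Cone.normalize) (UnitCone.continuous_toCone.comp continuous_subtype_val)
      Cone.continuous_normalize fun u => u.1.normalize_toCone
  have hsurj : Function.Surjective Cone.normalize := fun u => ⟨_, u.normalize_toCone⟩
  exact simply_connected_iff_paths_homotopic'.2
    ⟨hsurj.pathConnectedSpace Cone.continuous_normalize,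
      fun p q => h p q (subset_univ _) (subset_univ _)⟩

/-- The double cover `UnitCone → Y`. -/
def UnitCone.toY (u : UnitCone) : Y := SL3.toY u.toCone

theorem UnitCone.continuous_toY : Continuous UnitCone.toY :=
  SL3.continuous_toY.comp UnitCone.continuous_toCone

theorem toY_normalize (p : Cone) : p.normalize.toY = toY p :=
  Subtype.ext (plane_smul (inv_ne_zero (Real.sqrt_pos.2 (sum_sq_pos p.2.1)).ne') _)

theorem UnitCone.surjective_toY : Function.Surjective UnitCone.toY := fun l => by
  obtain ⟨p, rfl⟩ := SL3.toY_surjective l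
  exact ⟨_, toY_normalize p⟩

noncomputable instance : SMul ℤˣ UnitCone where
  smul c u := ⟨((c : ℤ) : ℝ) • u.1, by
    have h : (((c : ℤ) : ℝ)) ^ 2 = 1 := by exact_mod_cast Int.units_coe_mul_self c ▸ sq (c : ℤ)
    simp only [Pi.smul_apply, smul_eq_mul, mul_pow, h, one_mul]
    exact u.2.1, u.2.2.smul _⟩

theorem UnitCone.smul_val (c : ℤˣ) (u : UnitCone) : (c • u).1 = ((c : ℤ) : ℝ) • u.1 := rfl

noncomputable instance : MulAction ℤˣ UnitCone where
  one_smul u := Subtype.ext (by simp [UnitCone.smul_val])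
  mul_smul a b u := Subtype.ext (by simp [UnitCone.smul_val, mul_smul])

theorem UnitCone.neg_one_smul_ne (u : UnitCone) : (-1 : ℤˣ) • u ≠ u := by
  intro h
  have h1 := congrArg Subtype.val h
  rw [UnitCone.smul_val] at h1
  have : u.1 = 0 := by
    ext i
    have := congrFun h1 i
    simp only [Pi.smul_apply, smul_eq_mul, Units.val_neg, Units.val_one, Int.cast_neg,
      Int.cast_one] at this
    simp only [Pi.zero_apply]
    linarith
  exact u.toCone.2.1 this

instance : IsCancelSMul ℤˣ UnitCone := by
  refine isCancelSMul_iff_eq_one_of_smul_eq.2 fun c u h => ?_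
  rcases Int.units_eq_one_or c with rfl | rfl
  · rfl
  · exact absurd h u.neg_one_smul_ne

instance : ContinuousConstSMul ℤˣ UnitCone where
  continuous_const_smul c := by
    have h : Continuous fun u : UnitCone => ((c : ℤ) : ℝ) • u.1 :=
      continuous_pi fun i => continuous_const.mul ((continuous_apply i).comp continuous_subtype_val)
    exact h.subtype_mk fun u => (c • u).2

theorem UnitCone.toY_eq_iff {u v : UnitCone} :
    u.toY = v.toY ↔ u ∈ MulAction.orbit ℤˣ v := by
  constructor
  · intro h
    obtain ⟨c, -, hc⟩ := exists_smul_of_plane_eq u.2.2 u.toCone.2.1 v.toCone.2.1 v.2.2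
      (congrArg Subtype.val h)
    have hc' : u.1 = c • v.1 := hc
    have h2 : c ^ 2 = 1 := by
      have := u.2.1
      simpa only [hc', Pi.smul_apply, smul_eq_mul, mul_pow, ← Finset.mul_sum, v.2.1, mul_one]
        using this
    rcases mul_self_eq_one_iff.1 ((sq c).symm.trans h2) with rfl | rfl
    · exact ⟨1, Subtype.ext (by simp [hc'])⟩
    · exact ⟨-1, Subtype.ext (by simp [UnitCone.smul_val, hc'])⟩
  · rintro ⟨c, rfl⟩
    exact Subtype.ext (plane_smul (by simp) _)

/-- A continuous surjection from a compact space to a Hausdorff one is a quotient map; its fibres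
are the orbits of a free action of a finite group. -/
theorem isQuotientCoveringMap_toY : IsQuotientCoveringMap UnitCone.toY ℤˣ :=
  (UnitCone.continuous_toY.isClosedMap.isQuotientMap UnitCone.continuous_toY
    UnitCone.surjective_toY).isQuotientCoveringMap_of_properlyDiscontinuousSMul
    UnitCone.toY_eq_iff

instance : PathConnectedSpace Y :=
  UnitCone.surjective_toY.pathConnectedSpace UnitCone.continuous_toY

theorem nonempty_fundamentalGroup_mulEquiv (l : Y) :
    Nonempty (FundamentalGroup Y l ≃* Multiplicative (ZMod 2)) := by
  obtain ⟨u, hu⟩ := UnitCone.surjective_toY l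
  -- As the cover is simply connected, the fundamental group is the opposite of the deck group,
  -- which has order two.
  have e := isQuotientCoveringMap_toY.fundamentalGroupEquiv (x := l) ⟨u, hu⟩
  have : Fact (Nat.Prime 2) := ⟨Nat.prime_two⟩
  refine ⟨e.trans (mulEquivOfPrimeCardEq (p := 2) ?_ ?_)⟩
  · rw [Nat.card_congr MulOpposite.opEquiv.symm, Nat.card_eq_fintype_card]; rfl
  · rw [Nat.card_congr Multiplicative.toAdd, Nat.card_zmod]

/-! ### Loops around the projective line -/

/-- A plane is determined by the minors of a basis. -/
theorem plane_eq_span_of_minors {p : Fin 7 → ℝ} (hp : p ≠ 0) {X Z : Mat} (hX : X ∈ borel)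
    (hZ : Z ∈ borel)
    (h : ∀ i j, bivector p i j = coord X i * coord Z j - coord X j * coord Z i) :
    plane p = Submodule.span ℝ {X, Z} := by
  apply le_antisymm
  · have key : ∀ a, ofCoord (bivector p a) ∈ Submodule.span ℝ {X, Z} := fun a => by
      rw [Submodule.mem_span_pair]
      refine ⟨-coord Z a, coord X a, ?_⟩
      have hmem : -coord Z a • X + coord X a • Z ∈ borel.toSubmodule :=
        add_mem (Submodule.smul_mem _ _ hX) (Submodule.smul_mem _ _ hZ)
      rw [← ofCoord_coord hmem]
      congr 1
      ext j
      simp only [map_add, map_smul, Pi.add_apply, Pi.smul_apply, smul_eq_mul, h]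
      ring
    obtain ⟨a, b, hab⟩ := exists_bivector_ne_zero hp
    intro W hW
    rw [eq_of_mem_plane hab hW]
    exact add_mem (Submodule.smul_mem _ _ (key _)) (Submodule.smul_mem _ _ (key _))
  · rw [Submodule.span_le, Set.insert_subset_iff, Set.singleton_subset_iff]
    refine ⟨⟨hX, fun i j k => ?_⟩, ⟨hZ, fun i j k => ?_⟩⟩ <;>
    · simp only [h]; ring

theorem plane_projVec_zero {x y : ℝ} (h : (x, y) ≠ (0, 0)) :
    plane (projVec 0 x y) = nilPlane x y := by
  refine plane_eq_span_of_minors (fun h0 => h ?_) ?_ ?_ ?_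
  · have := projVec_eq_zero.1 h0
    simp [this.2.1, this.2.2]
  · simp [mem_borel_iff]
  · simp [mem_borel_iff]
  · intro i j
    fin_cases i <;> fin_cases j <;> simp [bivector, projVec, coord]

/-- The unit vectors over the circle `projLine`. -/
def circle : Set UnitCone := {u | u.1 0 = 0 ∧ u.1 1 = 0 ∧ u.1 2 = 0 ∧ u.1 3 = 0 ∧ u.1 4 = 0}

theorem UnitCone.eq_projVec {u : UnitCone} (hu : u ∈ circle) :
    u.1 = projVec 0 (u.1 5) (u.1 6) := by
  obtain ⟨h0, h1, h2, h3, h4⟩ := hu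
  conv_lhs => rw [SL3.eq_projVec h0 h1 h2 h4, h3]

theorem toY_mem_projLine {u : UnitCone} : u.toY ∈ projLine ↔ u ∈ circle := by
  constructor
  · rintro ⟨x, y, hxy, h⟩
    rw [← plane_projVec_zero hxy] at h
    obtain ⟨c, -, hc⟩ := exists_smul_of_plane_eq u.2.2 u.toCone.2.1 (fun h0 => hxy (by
      have := projVec_eq_zero.1 h0
      simp [this.2.1, this.2.2])) (pluckerRel_projVec _ _ _) h
    have hc' : u.1 = c • projVec 0 x y := hc
    refine ⟨?_, ?_, ?_, ?_, ?_⟩ <;> simp [hc', projVec]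
  · intro hu
    have hne : (u.1 5, u.1 6) ≠ ((0 : ℝ), (0 : ℝ)) := fun h0 => u.toCone.2.1 (by
      change u.1 = 0
      rw [UnitCone.eq_projVec hu, projVec_eq_zero]
      simpa using h0)
    refine ⟨_, _, hne, ?_⟩
    rw [← plane_projVec_zero hne, ← UnitCone.eq_projVec hu]
    rfl

/-- The unit vector at angle `t` of `circle`. -/
noncomputable def angle (t : ℝ) : UnitCone :=
  ⟨projVec 0 (Real.cos t) (Real.sin t), by simp [projVec, Fin.sum_univ_succ],
    pluckerRel_projVec _ _ _⟩

theorem continuous_angle : Continuous angle :=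
  (continuous_projVec continuous_const Real.continuous_cos Real.continuous_sin).subtype_mk _

theorem angle_mem_circle (t : ℝ) : angle t ∈ circle :=
  ⟨rfl, rfl, rfl, rfl, rfl⟩

theorem angle_add_pi (t : ℝ) : angle (t + Real.pi) = (-1 : ℤˣ) • angle t := by
  apply Subtype.ext
  rw [UnitCone.smul_val]
  ext i; fin_cases i <;> simp [angle, projVec]

theorem range_angle : range angle = circle := by
  apply subset_antisymm
  · rintro _ ⟨t, rfl⟩; exact angle_mem_circle t
  · intro u hu
    have h := u.2.1
    rw [UnitCone.eq_projVec hu] at h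
    have h : u.1 5 ^ 2 + u.1 6 ^ 2 = 1 := by simpa [projVec, Fin.sum_univ_succ] using h
    set z : ℂ := ⟨u.1 5, u.1 6⟩ with hz
    have hn : ‖z‖ = 1 := by
      rw [Complex.norm_eq_sqrt_sq_add_sq, h, Real.sqrt_one]
    have hz0 : z ≠ 0 := by rw [← norm_ne_zero_iff, hn]; exact one_ne_zero
    refine ⟨z.arg, Subtype.ext ?_⟩
    rw [UnitCone.eq_projVec hu]
    change projVec 0 (Real.cos z.arg) (Real.sin z.arg) = _
    rw [Complex.cos_arg hz0, Complex.sin_arg, hn, div_one, div_one]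

theorem isPreconnected_circle : IsPreconnected circle := by
  rw [← range_angle]
  exact isPreconnected_range continuous_angle

theorem UnitCone.eq_or_eq_neg {u v : UnitCone} (h : u.toY = v.toY) :
    u = v ∨ u = (-1 : ℤˣ) • v := by
  obtain ⟨c, rfl⟩ := UnitCone.toY_eq_iff.1 h
  rcases Int.units_eq_one_or c with rfl | rfl
  · exact .inl (one_smul _ _)
  · exact .inr rfl

theorem UnitCone.toY_smul (c : ℤˣ) (u : UnitCone) : (c • u).toY = u.toY :=
  UnitCone.toY_eq_iff.2 ⟨c, rfl⟩

/-- A path in `UnitCone` over a loop traversing `projLine` once is not closed. -/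
theorem lift_one_ne_of_traversesOnce {l : Y} {γ : Path l l} (hγ : TraversesOnce γ projLine)
    (Γ : C(unitInterval, UnitCone)) (hΓ : ∀ t, (Γ t).toY = γ t) : Γ 1 ≠ Γ 0 := by
  intro h10
  -- If the lift were closed, it would take a single value over each point of the circle, the
  -- coincidence of the two ends included.
  have hinj : ∀ s t : unitInterval, (Γ s).toY = (Γ t).toY → Γ s = Γ t := by
    have key : ∀ s : unitInterval, ∃ s' < (1 : unitInterval), Γ s' = Γ s := fun s => by
      rcases (unitInterval.le_one' (t := s)).lt_or_eq with h | rfl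
      · exact ⟨s, h, rfl⟩
      · exact ⟨0, zero_lt_one, h10.symm⟩
    intro s t hst
    obtain ⟨s', hs', hs⟩ := key s
    obtain ⟨t', ht', ht⟩ := key t
    rw [← hs, ← ht] at hst ⊢
    rw [hΓ, hΓ] at hst
    rw [hγ.2 hs' ht' hst]
  have hA : IsClosed (range Γ) := (isCompact_range Γ.continuous).isClosed
  have hB : IsClosed ((fun u : UnitCone => (-1 : ℤˣ) • u) '' range Γ) :=
    ((isCompact_range Γ.continuous).image (continuous_const_smul _)).isClosed
  have hmem : ∀ t, Γ t ∈ circle := fun t => by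
    rw [← toY_mem_projLine, hΓ, ← hγ.1]; exact mem_range_self t
  have hmem' : ∀ t, (-1 : ℤˣ) • Γ t ∈ circle := fun t => by
    rw [← toY_mem_projLine, UnitCone.toY_smul, toY_mem_projLine]; exact hmem t
  -- The range of the lift and its antipode are closed and cover the connected circle upstairs, so
  -- they meet; then two antipodal points are values of the lift over the same point.
  obtain ⟨u, -, ⟨s, rfl⟩, _, ⟨t, rfl⟩, ht⟩ :=
    isPreconnected_closed_iff.1 isPreconnected_circle _ _ hA hB (fun u hu => by
      have := toY_mem_projLine.2 hu
      rw [← hγ.1] at this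
      obtain ⟨t, ht⟩ := this
      rcases UnitCone.eq_or_eq_neg ((hΓ t).trans ht).symm with h | h
      · exact .inl ⟨t, h.symm⟩
      · exact .inr ⟨_, ⟨t, rfl⟩, h.symm⟩) ⟨_, hmem 0, mem_range_self 0⟩
      ⟨_, hmem' 0, _, mem_range_self 0, rfl⟩
  have h1 := hinj s t (by rw [← ht, UnitCone.toY_smul])
  rw [h1] at ht
  exact UnitCone.neg_one_smul_ne _ ht

/-- In a group of order two every nontrivial element generates. A trivial class would act trivially
on the fibre, making the lift closed. -/
theorem zpowers_eq_top_of_traversesOnce (l : Y) (γ : Path l l) (hγ : TraversesOnce γ projLine) :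
    Subgroup.zpowers (FundamentalGroup.fromPath (Path.Homotopic.Quotient.mk γ)) = ⊤ := by
  have : Fact (Nat.Prime 2) := ⟨Nat.prime_two⟩
  obtain ⟨e⟩ := nonempty_fundamentalGroup_mulEquiv l
  refine zpowers_eq_top_of_prime_card (p := 2) ?_ fun h1 => ?_
  · rw [Nat.card_congr e.toEquiv, Nat.card_congr Multiplicative.toAdd, Nat.card_zmod]
  · obtain ⟨u, hu⟩ := UnitCone.surjective_toY l
    have cov := isQuotientCoveringMap_toY.isCoveringMap
    have h0 : (γ : C(unitInterval, Y)) 0 = UnitCone.toY u := by simp [hu]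
    refine lift_one_ne_of_traversesOnce hγ (cov.liftPath γ u h0)
      (fun t => congrFun (cov.liftPath_lifts γ u h0) t) ?_
    rw [cov.liftPath_zero]
    have h2 : (Path.Homotopic.Quotient.mk γ) = Path.Homotopic.Quotient.refl l := h1
    have h3 : cov.monodromy (Path.Homotopic.Quotient.mk γ) ⟨u, hu⟩ = ⟨u, hu⟩ := by
      rw [h2, cov.monodromy_refl]; rfl
    exact congrArg Subtype.val h3

theorem periodic_angle_toY : Function.Periodic (fun t => (angle t).toY) Real.pi := fun t => by
  change (angle (t + Real.pi)).toY = (angle t).toY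
  rw [angle_add_pi, UnitCone.toY_smul]

theorem exists_traversesOnce (l : Y) (hl : l ∈ projLine) :
    ∃ γ : Path l l, TraversesOnce γ projLine := by
  obtain ⟨u, rfl⟩ := UnitCone.surjective_toY l
  rw [toY_mem_projLine, ← range_angle] at hl
  obtain ⟨a, rfl⟩ := hl
  -- A half turn suffices: increasing the angle by π gives the antipodal vector, hence the same
  -- plane.
  refine ⟨⟨⟨fun t => (angle (a + t * Real.pi)).toY, UnitCone.continuous_toY.comp
    (continuous_angle.comp (by fun_prop))⟩, by simp, ?_⟩, ?_, ?_⟩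
  · change (angle (a + (1 : ℝ) * Real.pi)).toY = _
    rw [one_mul, angle_add_pi, UnitCone.toY_smul]
  · apply subset_antisymm
    · rintro _ ⟨t, rfl⟩
      exact toY_mem_projLine.2 (angle_mem_circle _)
    · intro l hl
      obtain ⟨u, rfl⟩ := UnitCone.surjective_toY l
      rw [toY_mem_projLine, ← range_angle] at hl
      obtain ⟨b, rfl⟩ := hl
      have hmem := toIcoMod_mem_Ico Real.pi_pos a b
      have hper : (angle (toIcoMod Real.pi_pos a b)).toY = (angle b).toY :=
        periodic_angle_toY.sub_zsmul_eq _
      refine ⟨⟨(toIcoMod Real.pi_pos a b - a) / Real.pi, ?_, ?_⟩, ?_⟩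
      · exact div_nonneg (by linarith [hmem.1]) Real.pi_pos.le
      · rw [div_le_one Real.pi_pos]; linarith [hmem.2]
      · change (angle (a + (toIcoMod Real.pi_pos a b - a) / Real.pi * Real.pi)).toY = _
        rw [div_mul_cancel₀ _ Real.pi_ne_zero, add_sub_cancel, hper]
  · intro s hs t ht hst
    -- Equal or antipodal unit vectors have angles whose difference has sine zero; here that
    -- difference is less than π in absolute value.
    have h0 : Real.sin ((a + s * Real.pi) - (a + t * Real.pi)) = 0 := by
      rw [Real.sin_sub]
      change (angle (a + s * Real.pi)).toY = (angle (a + t * Real.pi)).toY at hst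
      rcases UnitCone.eq_or_eq_neg hst with h | h
      · have h5 : Real.cos (a + s * Real.pi) = Real.cos (a + t * Real.pi) :=
          congrFun (congrArg Subtype.val h) 5
        have h6 : Real.sin (a + s * Real.pi) = Real.sin (a + t * Real.pi) :=
          congrFun (congrArg Subtype.val h) 6
        rw [h5, h6]; ring
      · rw [← angle_add_pi] at h
        have h5 : Real.cos (a + s * Real.pi) = Real.cos (a + t * Real.pi + Real.pi) :=
          congrFun (congrArg Subtype.val h) 5
        have h6 : Real.sin (a + s * Real.pi) = Real.sin (a + t * Real.pi + Real.pi) :=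
          congrFun (congrArg Subtype.val h) 6
        rw [h5, h6, Real.cos_add_pi, Real.sin_add_pi]; ring
    have hs1 : (s : ℝ) < 1 := hs
    have ht1 : (t : ℝ) < 1 := ht
    have h1 := (Real.sin_eq_zero_iff_of_lt_of_lt (by nlinarith [Real.pi_pos, s.2.1])
      (by nlinarith [Real.pi_pos, t.2.1])).1 h0
    have h2 : ((s : ℝ) - t) * Real.pi = 0 := by linarith
    have h3 := (mul_eq_zero.1 h2).resolve_right Real.pi_ne_zero
    exact Subtype.ext (by linarith)

/-! ### The `2`-skeleton in Plücker coordinates -/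

theorem Ad_mul (g : Matrix.SpecialLinearGroup (Fin 3) ℝ) (X : Mat) :
    Ad g X * (g : Mat) = (g : Mat) * X := by
  change (g : Mat) * X * ((g⁻¹ : Matrix.SpecialLinearGroup (Fin 3) ℝ) : Mat) * (g : Mat) = _
  rw [mul_assoc, ← Matrix.SpecialLinearGroup.coe_mul, inv_mul_cancel,
    Matrix.SpecialLinearGroup.coe_one, mul_one]

theorem Ad_eq {g : Matrix.SpecialLinearGroup (Fin 3) ℝ} {X Z : Mat}
    (h : (g : Mat) * X = Z * (g : Mat)) : Ad g X = Z := by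
  change (g : Mat) * X * ((g⁻¹ : Matrix.SpecialLinearGroup (Fin 3) ℝ) : Mat) = _
  rw [h, mul_assoc, ← Matrix.SpecialLinearGroup.coe_mul, mul_inv_cancel,
    Matrix.SpecialLinearGroup.coe_one, mul_one]

theorem Ad_apply_self {g : Matrix.SpecialLinearGroup (Fin 3) ℝ} (hg : g ∈ B₀) {X : Mat}
    (hX : X.BlockTriangular id) (hZ : (Ad g X).BlockTriangular id) (i : Fin 3) :
    Ad g X i i = X i i := by
  have h := congrFun (congrFun (Ad_mul g X) i) i
  have g10 : (g : Mat) 1 0 = 0 := hg.1 (by decide)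
  have g20 : (g : Mat) 2 0 = 0 := hg.1 (by decide)
  have g21 : (g : Mat) 2 1 = 0 := hg.1 (by decide)
  have x10 : X 1 0 = 0 := hX (by decide)
  have x20 : X 2 0 = 0 := hX (by decide)
  have x21 : X 2 1 = 0 := hX (by decide)
  have z10 : Ad g X 1 0 = 0 := hZ (by decide)
  have z20 : Ad g X 2 0 = 0 := hZ (by decide)
  have z21 : Ad g X 2 1 = 0 := hZ (by decide)
  have hi := hg.2 i
  apply mul_right_cancel₀ hi.ne'
  fin_cases i <;>
  · simp [Matrix.mul_apply, Fin.sum_univ_three, *] at h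
    exact h.trans (mul_comm _ _)

theorem blockTriangular_iff {X : Mat} :
    X.BlockTriangular id ↔ X 1 0 = 0 ∧ X 2 0 = 0 ∧ X 2 1 = 0 := by
  refine ⟨fun h => ⟨h (by decide), h (by decide), h (by decide)⟩, ?_⟩
  rintro ⟨h1, h2, h3⟩ i j hij
  fin_cases i <;> fin_cases j <;> simp_all

theorem mem_cartan_iff {X : Mat} : X ∈ cartan ↔
    ∃ a b : ℝ, X = !![a, 0, 0; 0, b, 0; 0, 0, -a - b] := by
  constructor
  · rintro ⟨h, ht⟩
    refine ⟨X 0 0, X 1 1, ?_⟩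
    rw [Matrix.trace_fin_three] at ht
    ext i j
    fin_cases i <;> fin_cases j <;> simp
    all_goals first | exact h (by decide) | linarith
  · rintro ⟨a, b, rfl⟩
    refine ⟨fun i j hij => ?_, ?_⟩
    · fin_cases i <;> fin_cases j <;> simp_all
    · rw [Matrix.trace_fin_three]; simp

theorem rootPlane_eq_span {i j : Fin 3} {D : Mat} (hD : D ∈ cartan) (hr : root i j D = 0)
    (h : ∀ X ∈ cartan, root i j X = 0 → ∃ t : ℝ, t • D = X) :
    rootPlane i j = Submodule.span ℝ {D, Matrix.single i j 1} := by
  rw [rootPlane, Submodule.span_insert]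
  congr 1
  apply le_antisymm
  · rintro X ⟨hX, hX'⟩
    exact Submodule.mem_span_singleton.2 (h X hX hX')
  · rw [Submodule.span_singleton_le_iff_mem]
    exact ⟨hD, hr⟩

theorem rootPlane_zero_one : rootPlane 0 1 =
    Submodule.span ℝ {!![1/3, 0, 0; 0, 1/3, 0; 0, 0, -2/3], !![0, 1, 0; 0, 0, 0; 0, 0, 0]} := by
  have : (!![0, 1, 0; 0, 0, 0; 0, 0, 0] : Mat) = Matrix.single 0 1 1 := by
    ext i j; fin_cases i <;> fin_cases j <;> simp [Matrix.single]
  rw [this]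
  refine rootPlane_eq_span (mem_cartan_iff.2 ⟨1/3, 1/3, by norm_num⟩) (by simp [root]) ?_
  intro X hX hr
  obtain ⟨a, b, rfl⟩ := mem_cartan_iff.1 hX
  have hab : a - b = 0 := by simpa [root] using hr
  refine ⟨3 * a, ?_⟩
  ext i j; fin_cases i <;> fin_cases j <;> simp <;> linarith

theorem rootPlane_one_two : rootPlane 1 2 =
    Submodule.span ℝ {!![-2/3, 0, 0; 0, 1/3, 0; 0, 0, 1/3], !![0, 0, 0; 0, 0, 1; 0, 0, 0]} := by
  have : (!![0, 0, 0; 0, 0, 1; 0, 0, 0] : Mat) = Matrix.single 1 2 1 := by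
    ext i j; fin_cases i <;> fin_cases j <;> simp [Matrix.single]
  rw [this]
  refine rootPlane_eq_span (mem_cartan_iff.2 ⟨-2/3, 1/3, by norm_num⟩) (by simp [root]) ?_
  intro X hX hr
  obtain ⟨a, b, rfl⟩ := mem_cartan_iff.1 hX
  have hab : b - (-a - b) = 0 := by simpa [root] using hr
  refine ⟨3 * b, ?_⟩
  ext i j; fin_cases i <;> fin_cases j <;> simp <;> linarith

theorem rootPlane_zero_two : rootPlane 0 2 =
    Submodule.span ℝ {!![-1/3, 0, 0; 0, 2/3, 0; 0, 0, -1/3], !![0, 0, 1; 0, 0, 0; 0, 0, 0]} := by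
  have : (!![0, 0, 1; 0, 0, 0; 0, 0, 0] : Mat) = Matrix.single 0 2 1 := by
    ext i j; fin_cases i <;> fin_cases j <;> simp [Matrix.single]
  rw [this]
  refine rootPlane_eq_span (mem_cartan_iff.2 ⟨-1/3, 2/3, by norm_num⟩) (by simp [root]) ?_
  intro X hX hr
  obtain ⟨a, b, rfl⟩ := mem_cartan_iff.1 hX
  have hab : a - (-a - b) = 0 := by simpa [root] using hr
  refine ⟨-3 * a, ?_⟩
  ext i j; fin_cases i <;> fin_cases j <;> simp <;> linarith

/-- The diagonal parts of such a plane span at most a line, on which (u, v) vanishes. This is what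
separates these cells from the orbit of 𝔞. -/
theorem exists_linear_relation_of_mem_cellReps {k : ℕ} (hk : k ≤ 2) {l : Submodule ℝ Mat}
    (hl : l ∈ cellReps k) : ∃ u v : ℝ, (u ≠ 0 ∨ v ≠ 0) ∧
      ∀ X ∈ l, X.BlockTriangular id ∧ u * coord X 0 + v * coord X 1 = 0 := by
  have key : ∀ (A B : Mat) (u v : ℝ), A.BlockTriangular id → B.BlockTriangular id →
      u * coord A 0 + v * coord A 1 = 0 → u * coord B 0 + v * coord B 1 = 0 →
      ∀ X ∈ Submodule.span ℝ {A, B},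
        X.BlockTriangular id ∧ u * coord X 0 + v * coord X 1 = 0 := by
    intro A B u v hA hB hA' hB' X hX
    obtain ⟨s, t, rfl⟩ := Submodule.mem_span_pair.1 hX
    refine ⟨fun i j hij => by simp [hA hij, hB hij], ?_⟩
    simp only [map_add, map_smul, Pi.add_apply, Pi.smul_apply, smul_eq_mul]
    linear_combination s * hA' + t * hB'
  interval_cases k
  · refine ⟨1, 0, by simp, ?_⟩
    rcases hl with rfl | rfl <;> apply key <;> simp [blockTriangular_iff, coord]
  · refine ⟨1, 0, by simp, ?_⟩
    rcases hl with rfl | rfl <;> apply key <;> simp [blockTriangular_iff, coord]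
  · rcases hl with rfl | rfl | rfl
    · rw [rootPlane_zero_one]
      refine ⟨1, 0, by simp, ?_⟩
      apply key <;> simp [blockTriangular_iff, coord]
    · rw [rootPlane_one_two]
      refine ⟨1, -1, by simp, ?_⟩
      apply key <;> simp [blockTriangular_iff, coord]
    · rw [rootPlane_zero_two]
      refine ⟨0, 1, by simp, ?_⟩
      apply key <;> simp [blockTriangular_iff, coord]

/-- The linear relation on diagonals survives the action of B₀. The rows 0 and 1 of the bivector
begin with (0, p 0) and (-p 0, 0), so it gives v p 0 = 0 and u p 0 = 0. -/
theorem apply_zero_of_toY_mem_skeleton {p : Cone} (h : toY p ∈ skeleton 2) : p.1 0 = 0 := by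
  obtain ⟨k, hk, l₀, hl₀, g, hg, h⟩ := h
  obtain ⟨u, v, huv, hrel⟩ := exists_linear_relation_of_mem_cellReps hk hl₀
  have key : ∀ Z ∈ plane p.1, u * coord Z 0 + v * coord Z 1 = 0 := by
    intro Z hZ
    have hZt := hZ.1.2
    have hZ' : Z ∈ (toY p).1 := hZ
    rw [h] at hZ'
    obtain ⟨X, hX, rfl⟩ := hZ'
    obtain ⟨h1, h2⟩ := hrel X hX
    have := Ad_apply_self hg h1 hZt
    simpa [coord, this] using h2
  have h0 := key _ (ofCoord_row_mem_plane p.2.2 0)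
  have h1 := key _ (ofCoord_row_mem_plane p.2.2 1)
  rw [coord_ofCoord] at h0 h1
  simp [bivector] at h0 h1
  tauto

/-- Certificate for membership in an orbit: g carries the basis A, B of a representative to Z, W,
whose minors are the coordinates of p up to a scalar. -/
theorem toY_mem_skeleton_of_minors {p : Cone} {q : Fin 7 → ℝ} {c : ℝ} (hpq : p.1 = c • q) {k : ℕ}
    (hk : k ≤ 2) {A B Z W : Mat} (hl : Submodule.span ℝ {A, B} ∈ cellReps k)
    (g : Mat) (hdet : g.det = 1) (hg : g.BlockTriangular id ∧ ∀ i, 0 < g i i)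
    (hA : g * A = Z * g) (hB : g * B = W * g) (hZ : Z ∈ borel) (hW : W ∈ borel)
    (h : ∀ i j, bivector q i j = coord Z i * coord W j - coord Z j * coord W i) :
    toY p ∈ skeleton 2 := by
  have hc : c ≠ 0 := by rintro rfl; exact p.2.1 (by simp [hpq])
  have hq : q ≠ 0 := by rintro rfl; exact p.2.1 (by simp [hpq])
  refine ⟨k, hk, _, hl, ⟨g, hdet⟩, hg, ?_⟩
  change plane p.1 = _
  rw [hpq, plane_smul hc, plane_eq_span_of_minors hq hZ hW h, Submodule.map_span, image_pair,
    Ad_eq (g := ⟨g, hdet⟩) hA, Ad_eq (g := ⟨g, hdet⟩) hB]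

/-- The cell of 𝔩_α: once p 1 is scaled to 1, the coordinates p 4 and p 5 are free and p 6 is
determined. -/
theorem PluckerRel.eq_of_apply_one_ne_zero {p : Fin 7 → ℝ} (h : PluckerRel p) (h0 : p 0 = 0)
    (h1 : p 1 ≠ 0) : p 2 = 0 ∧ p 3 = 0 ∧ p 1 * p 6 = - p 4 ^ 2 := by
  have h2 : p 2 = 0 := by
    have := h.r0; rw [h0] at this; simpa [h1] using this
  have h3 : p 3 = 0 := by
    have := h.r1; rw [h0] at this; simpa [h1] using this
  have := h.r4
  rw [h2] at this
  exact ⟨h2, h3, by linarith⟩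

/-- The cell of 𝔩_β: once p 2 is scaled to 1, the coordinates p 4 and p 6 are free and p 5 is
determined. -/
theorem PluckerRel.eq_of_apply_two_ne_zero {p : Fin 7 → ℝ} (h : PluckerRel p) (h0 : p 0 = 0)
    (h2 : p 2 ≠ 0) : p 1 = 0 ∧ p 3 = p 4 ∧ p 2 * p 5 = p 4 ^ 2 := by
  have h1 : p 1 = 0 := by
    have := h.r0; rw [h0] at this; simpa [h2] using this
  have h3 : p 3 = p 4 := by
    have := h.r2; rw [h0] at this
    apply mul_left_cancel₀ h2; linarith
  have := h.r4
  rw [h1] at this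
  exact ⟨h1, h3, by linarith⟩

theorem PluckerRel.eq_projVec {p : Fin 7 → ℝ} (h : PluckerRel p) (h0 : p 0 = 0)
    (h1 : p 1 = 0) (h2 : p 2 = 0) : p = projVec (p 3) (p 5) (p 6) := by
  refine SL3.eq_projVec h0 h1 h2 ?_
  have := h.r4
  rw [h1, h2] at this
  simpa using this

/-- For the converse, the first nonzero coordinate among p 1, p 2, p 3 tells which of 𝔩_α, 𝔩_β,
𝔩_{α+β} has p in its orbit, and a unipotent g does the moving. If all three vanish, p lies over the
circle ℙ¹(ℝ). -/
theorem toY_mem_skeleton {p : Cone} : toY p ∈ skeleton 2 ↔ p.1 0 = 0 := by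
  refine ⟨apply_zero_of_toY_mem_skeleton, fun h0 => ?_⟩
  by_cases h1 : p.1 1 = 0
  swap
  · obtain ⟨h2, h3, h6⟩ := p.2.2.eq_of_apply_one_ne_zero h0 h1
    set a := p.1 4 / p.1 1 with ha
    set b := p.1 5 / p.1 1 with hb
    refine toY_mem_skeleton_of_minors (c := -p.1 1) (q := ![0, -1, 0, 0, -a, -b, a ^ 2]) (k := 2)
      (Z := !![1/3, 0, b; 0, 1/3, a; 0, 0, -2/3]) (W := !![0, 1, a; 0, 0, 0; 0, 0, 0]) ?_
      le_rfl (Or.inl rootPlane_zero_one.symm) !![1, 0, -b; 0, 1, -a; 0, 0, 1] ?_ ⟨?_, ?_⟩ ?_ ?_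
      ?_ ?_ ?_
    · have e4 : p.1 4 = p.1 1 * a := by rw [ha]; field_simp
      have e5 : p.1 5 = p.1 1 * b := by rw [hb]; field_simp
      have e6 : p.1 6 = -p.1 1 * a ^ 2 := by
        apply mul_left_cancel₀ h1; rw [h6, e4]; ring
      ext i; fin_cases i <;> simp [h0, h2, h3, e4, e5, e6]
    · simp [Matrix.det_fin_three]
    · simp [blockTriangular_iff]
    · intro i; fin_cases i <;> simp
    · ext i j
      fin_cases i <;> fin_cases j <;> simp [Matrix.mul_apply, Fin.sum_univ_three] <;> ring
    · ext i j
      fin_cases i <;> fin_cases j <;> simp [Matrix.mul_apply, Fin.sum_univ_three]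
    · simp [mem_borel_iff]; norm_num
    · simp [mem_borel_iff]
    · intro i j
      fin_cases i <;> fin_cases j <;> simp [bivector, coord] <;> ring
  by_cases h2 : p.1 2 = 0
  swap
  · obtain ⟨h1, h3, h6⟩ := p.2.2.eq_of_apply_two_ne_zero h0 h2
    set a := p.1 4 / p.1 2 with ha
    set b := p.1 6 / p.1 2 with hb
    refine toY_mem_skeleton_of_minors (c := p.1 2) (q := ![0, 0, 1, a, a, a ^ 2, b]) (k := 2)
      (Z := !![-2/3, a, -b; 0, 1/3, 0; 0, 0, 1/3]) (W := !![0, 0, a; 0, 0, 1; 0, 0, 0]) ?_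
      le_rfl (Or.inr (Or.inl rootPlane_one_two.symm)) !![1, a, -b; 0, 1, 0; 0, 0, 1] ?_ ⟨?_, ?_⟩
      ?_ ?_ ?_ ?_ ?_
    · have e4 : p.1 4 = p.1 2 * a := by rw [ha]; field_simp
      have e6 : p.1 6 = p.1 2 * b := by rw [hb]; field_simp
      have e5 : p.1 5 = p.1 2 * a ^ 2 := by
        apply mul_left_cancel₀ h2; rw [h6, e4]; ring
      ext i; fin_cases i <;> simp [h0, h1, h3, e4, e5, e6]
    · simp [Matrix.det_fin_three]
    · simp [blockTriangular_iff]
    · intro i; fin_cases i <;> simp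
    · ext i j
      fin_cases i <;> fin_cases j <;> simp [Matrix.mul_apply, Fin.sum_univ_three] <;> ring
    · ext i j
      fin_cases i <;> fin_cases j <;> simp [Matrix.mul_apply, Fin.sum_univ_three]
    · simp [mem_borel_iff]; norm_num
    · simp [mem_borel_iff]
    · intro i j
      fin_cases i <;> fin_cases j <;> simp [bivector, coord] <;> ring
  have hp := p.2.2.eq_projVec h0 h1 h2
  by_cases h3 : p.1 3 = 0
  swap
  · set a := p.1 5 / p.1 3 with ha
    set b := p.1 6 / p.1 3 with hb
    refine toY_mem_skeleton_of_minors (c := p.1 3) (q := projVec 1 a b) (k := 2)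
      (Z := !![-1/3, a, a * b; 0, 2/3, b; 0, 0, -1/3]) (W := !![0, 0, 1; 0, 0, 0; 0, 0, 0]) ?_
      le_rfl (Or.inr (Or.inr rootPlane_zero_two.symm)) !![1, a, 0; 0, 1, -b; 0, 0, 1] ?_ ⟨?_, ?_⟩
      ?_ ?_ ?_ ?_ ?_
    · have e5 : p.1 5 = p.1 3 * a := by rw [ha]; field_simp
      have e6 : p.1 6 = p.1 3 * b := by rw [hb]; field_simp
      rw [hp]
      ext i; fin_cases i <;> simp [projVec, e5, e6]
    · simp [Matrix.det_fin_three]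
    · simp [blockTriangular_iff]
    · intro i; fin_cases i <;> simp
    · ext i j
      fin_cases i <;> fin_cases j <;> simp [Matrix.mul_apply, Fin.sum_univ_three] <;> ring
    · ext i j
      fin_cases i <;> fin_cases j <;> simp [Matrix.mul_apply, Fin.sum_univ_three]
    · simp [mem_borel_iff]; norm_num
    · simp [mem_borel_iff]
    · intro i j
      fin_cases i <;> fin_cases j <;> simp [bivector, coord, projVec] <;> ring
  rw [h3] at hp
  have hone : (1 : Mat).BlockTriangular id ∧ ∀ i, 0 < (1 : Mat) i i :=
    ⟨Matrix.blockTriangular_one, fun i => by simp⟩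
  by_cases h6 : p.1 6 = 0
  · refine toY_mem_skeleton_of_minors (c := p.1 5) (q := projVec 0 1 0) (k := 0)
      ?_ zero_le_two (Or.inl rfl) 1 Matrix.det_one hone (by rw [mul_one, one_mul])
      (by rw [mul_one, one_mul]) ?_ ?_ ?_
    · rw [hp, h6]
      ext i; fin_cases i <;> simp [projVec]
    · simp [mem_borel_iff]
    · simp [mem_borel_iff]
    · intro i j
      fin_cases i <;> fin_cases j <;> simp [bivector, coord, projVec]
  by_cases h5 : p.1 5 = 0
  · refine toY_mem_skeleton_of_minors (c := p.1 6) (q := projVec 0 0 1) (k := 0)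
      ?_ zero_le_two (Or.inr rfl) 1 Matrix.det_one hone (by rw [mul_one, one_mul])
      (by rw [mul_one, one_mul]) ?_ ?_ ?_
    · rw [hp, h5]
      ext i; fin_cases i <;> simp [projVec]
    · simp [mem_borel_iff]
    · simp [mem_borel_iff]
    · intro i j
      fin_cases i <;> fin_cases j <;> simp [bivector, coord, projVec]
  -- The matrix diag (1, d, d⁻¹) takes [1 : ε] to [d⁻¹ : ε d²] = [1 : ε d³], so d is the cube root
  -- of |p 6 / p 5| and ε its sign.
  obtain ⟨d, ε, hd, hε, hdε⟩ : ∃ d ε : ℝ, 0 < d ∧ (ε = 1 ∨ ε = -1) ∧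
      p.1 6 = p.1 5 * (ε * d ^ 3) := by
    have hne : 0 < |p.1 6 / p.1 5| := abs_pos.2 (div_ne_zero h6 h5)
    have hcube : Real.exp (Real.log |p.1 6 / p.1 5| / 3) ^ 3 = |p.1 6 / p.1 5| := by
      rw [← Real.exp_nat_mul, Nat.cast_ofNat, mul_div_cancel₀ _ (by norm_num), Real.exp_log hne]
    rcases abs_choice (p.1 6 / p.1 5) with h | h
    · refine ⟨_, 1, Real.exp_pos (Real.log |p.1 6 / p.1 5| / 3), .inl rfl, ?_⟩
      rw [hcube, h]; field_simp
    · refine ⟨_, -1, Real.exp_pos (Real.log |p.1 6 / p.1 5| / 3), .inr rfl, ?_⟩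
      rw [hcube, h]; field_simp
  have hd0 := hd.ne'
  refine toY_mem_skeleton_of_minors (c := p.1 5) (q := projVec 0 1 (ε * d ^ 3)) (k := 1)
    (A := !![0, 1, 0; 0, 0, ε; 0, 0, 0]) (B := !![0, 0, 1; 0, 0, 0; 0, 0, 0])
    (Z := !![0, d⁻¹, 0; 0, 0, ε * d ^ 2; 0, 0, 0]) (W := !![0, 0, d; 0, 0, 0; 0, 0, 0]) ?_
    one_le_two ?_ !![1, 0, 0; 0, d, 0; 0, 0, d⁻¹] ?_ ⟨?_, ?_⟩ ?_ ?_ ?_ ?_ ?_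
  · rw [hp, hdε]
    ext i; fin_cases i <;> simp [projVec]
  · rcases hε with rfl | rfl
    · exact Or.inl rfl
    · exact Or.inr rfl
  · simp [Matrix.det_fin_three, hd0]
  · simp [blockTriangular_iff]
  · intro i; fin_cases i <;> simp [hd]
  · ext i j
    fin_cases i <;> fin_cases j <;> simp [Matrix.mul_apply, Fin.sum_univ_three] <;> field_simp
  · ext i j
    fin_cases i <;> fin_cases j <;> simp [Matrix.mul_apply, Fin.sum_univ_three]
    field_simp
  · simp [mem_borel_iff]
  · simp [mem_borel_iff]
  · intro i j
    fin_cases i <;> fin_cases j <;> simp [bivector, coord, projVec] <;> field_simp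

end SL3

/-! ### Attaching cones to the real projective plane -/

theorem continuous_of_boolCircle {A B T : Type*} [TopologicalSpace A] [TopologicalSpace B]
    [TopologicalSpace T] {f : (Bool × A) × B → T}
    (h : ∀ i, Continuous fun p : A × B => f ((i, p.1), p.2)) : Continuous f := by
  have : Continuous (f ∘ (Homeomorph.prodAssoc Bool A B).symm) :=
    continuous_prod_of_discrete_left.2 h
  simpa [Function.comp_assoc] using this.comp (Homeomorph.prodAssoc Bool A B).continuous

/-- The map from the compact disjoint union of base and cylinder to the Hausdorff space Z is closed,
hence a quotient map; the last three hypotheses say that it makes no identifications beyond those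
prescribed. -/
theorem IsConeAttachment.of_compact {A K X Z : Type} [TopologicalSpace A] [TopologicalSpace X]
    [TopologicalSpace Z] [CompactSpace A] [CompactSpace X] [T2Space Z] {π : A → K} {φ : C(A, X)}
    {ι : C(X, Z)} {Φ : C(A × unitInterval, Z)} (apex : ∀ a b, π a = π b → Φ (a, 0) = Φ (b, 0))
    (base : ∀ a, Φ (a, 1) = ι (φ a)) (surj : ∀ z, (∃ x, ι x = z) ∨ ∃ q, Φ q = z)
    (inj : Function.Injective ι) (hbase : ∀ q x, Φ q = ι x → q.2 = 1)
    (hcone : ∀ q q', Φ q = Φ q' → q.2 ≠ 1 → q'.2 ≠ 1 →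
      q = q' ∨ q.2 = 0 ∧ q'.2 = 0 ∧ π q.1 = π q'.1) :
    IsConeAttachment π φ ι Φ where
  apex := apex
  base := base
  surj := surj
  desc T _ f h hapex hf := by
    let P : C(X ⊕ A × unitInterval, Z) := ⟨Sum.elim ι Φ, by fun_prop⟩
    let Q : C(X ⊕ A × unitInterval, T) := ⟨Sum.elim f h, by fun_prop⟩
    have hP : IsQuotientMap P := by
      refine P.continuous.isClosedMap.isQuotientMap P.continuous fun z => ?_
      rcases surj z with ⟨x, hx⟩ | ⟨q, hq⟩
      · exact ⟨.inl x, hx⟩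
      · exact ⟨.inr q, hq⟩
    have hone : ∀ q x, Φ q = ι x → h q = f x := by
      rintro ⟨a, r⟩ x hq
      obtain rfl : r = 1 := hbase _ _ hq
      rw [hf, inj (by rw [← base, hq] : ι (φ a) = ι x)]
    have hfac : Function.FactorsThrough Q P := by
      rintro (x | q) (x' | q') hq
      · exact congrArg f (inj hq)
      · exact (hone q' x hq.symm).symm
      · exact hone q x' hq
      · change h q = h q'
        replace hq : Φ q = Φ q' := hq
        obtain ⟨a, r⟩ := q
        obtain ⟨a', r'⟩ := q'
        by_cases hr : r = 1
        · subst hr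
          rw [hf, hone (a', r') (φ a) (by rw [← base, hq])]
        by_cases hr' : r' = 1
        · subst hr'
          rw [hf, hone (a, r) (φ a') (by rw [← base, hq])]
        rcases hcone _ _ hq hr hr' with h1 | ⟨h1, h2, h3⟩
        · rw [h1]
        · obtain rfl : r = 0 := h1
          obtain rfl : r' = 0 := h2
          exact hapex _ _ h3
    refine ⟨hP.lift Q hfac, fun x => ?_, fun q => ?_⟩
    · exact DFunLike.congr_fun (hP.lift_comp Q hfac) (.inl x)
    · exact DFunLike.congr_fun (hP.lift_comp Q hfac) (.inr q)

theorem Circle.exists_eq_mul {x y r : ℝ} (hr : 0 ≤ r) (h : x ^ 2 + y ^ 2 = r ^ 2) :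
    ∃ z : Circle, r * (z : ℂ).re = x ∧ r * (z : ℂ).im = y := by
  have hn : ‖(⟨x, y⟩ : ℂ)‖ = r := by
    rw [Complex.norm_eq_sqrt_sq_add_sq, h, Real.sqrt_sq hr]
  have := Complex.norm_mul_exp_arg_mul_I ⟨x, y⟩
  rw [hn] at this
  refine ⟨Circle.exp (Complex.arg ⟨x, y⟩), ?_, ?_⟩
  · simpa using congrArg Complex.re this
  · simpa using congrArg Complex.im this

theorem Circle.re_sq_add_im_sq (z : Circle) : (z : ℂ).re ^ 2 + (z : ℂ).im ^ 2 = 1 := by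
  have := Circle.normSq_coe z
  rw [Complex.normSq_apply] at this
  linarith

theorem Circle.continuous_re : Continuous fun z : Circle => (z : ℂ).re :=
  Complex.continuous_re.comp continuous_subtype_val

theorem Circle.continuous_im : Continuous fun z : Circle => (z : ℂ).im :=
  Complex.continuous_im.comp continuous_subtype_val

namespace RealProjectivePlane

/-- The line through a nonzero vector. -/
noncomputable def mk (v : Fin 3 → ℝ) (hv : v ≠ 0) : RealProjectivePlane := Projectivization.mk ℝ v hv

theorem continuous_mk {T : Type*} [TopologicalSpace T] {f : T → Fin 3 → ℝ} (hf : Continuous f)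
    (h0 : ∀ t, f t ≠ 0) : Continuous fun t => mk (f t) (h0 t) :=
  continuous_quot_mk.comp (hf.subtype_mk h0)

theorem mk_eq_mk_iff {v w : Fin 3 → ℝ} (hv : v ≠ 0) (hw : w ≠ 0) :
    mk v hv = mk w hw ↔ ∃ a : ℝ, a • w = v :=
  Projectivization.mk_eq_mk_iff' ℝ v w hv hw

theorem exists_mk (x : RealProjectivePlane) : ∃ v hv, mk v hv = x :=
  ⟨_, _, Projectivization.mk_rep x⟩

instance : CompactSpace RealProjectivePlane := by
  have h0 : ∀ v : Metric.sphere (0 : Fin 3 → ℝ) 1, v.1 ≠ 0 := fun v =>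
    ne_zero_of_mem_unit_sphere v
  have hc : Continuous fun v : Metric.sphere (0 : Fin 3 → ℝ) 1 => mk v.1 (h0 v) :=
    continuous_mk continuous_subtype_val h0
  have hs : Function.Surjective fun v : Metric.sphere (0 : Fin 3 → ℝ) 1 => mk v.1 (h0 v) := by
    intro x
    obtain ⟨v, hv, rfl⟩ := exists_mk x
    have hn : ‖v‖ ≠ 0 := norm_ne_zero_iff.2 hv
    refine ⟨⟨‖v‖⁻¹ • v, ?_⟩, ?_⟩
    · simp [norm_smul, hn]
    · exact (mk_eq_mk_iff _ _).2 ⟨‖v‖⁻¹, rfl⟩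
  exact hs.compactSpace hc

end RealProjectivePlane

/-! ### The sphere as a collapsed cylinder, and the wedge -/

namespace Sphere2

/-- The point of the sphere in the direction `z` whose last coordinate is `2 * r - 1`. -/
noncomputable def ofPolar (q : Circle × unitInterval) : Sphere2 :=
  ⟨!₂[2 * √((q.2 : ℝ) * (1 - q.2)) * (q.1 : ℂ).re, 2 * √((q.2 : ℝ) * (1 - q.2)) * (q.1 : ℂ).im,
    2 * (q.2 : ℝ) - 1], by
    rw [EuclideanSpace.sphere_zero_eq 1 zero_le_one]
    have h1 := Circle.re_sq_add_im_sq q.1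
    have h2 := Real.sq_sqrt (mul_nonneg q.2.2.1 (sub_nonneg.2 q.2.2.2))
    simp only [mem_ofPred_eq, Fin.sum_univ_three, Matrix.cons_val, mul_pow, h2]
    linear_combination 4 * ((q.2 : ℝ) * (1 - q.2)) * h1⟩

theorem continuous_ofPolar : Continuous ofPolar := by
  have h1 := Circle.continuous_re
  have h2 := Circle.continuous_im
  refine Continuous.subtype_mk ((PiLp.continuous_toLp 2 _).comp ?_) _
  refine continuous_pi fun i => ?_
  fin_cases i <;> simp <;> fun_prop

theorem surjective_ofPolar : Function.Surjective ofPolar := by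
  intro ⟨v, hv⟩
  rw [EuclideanSpace.sphere_zero_eq 1 zero_le_one] at hv
  simp only [mem_ofPred_eq, Fin.sum_univ_three] at hv
  have h2 : |v 2| ≤ 1 := by
    rw [← sq_le_one_iff_abs_le_one]; nlinarith [sq_nonneg (v 0), sq_nonneg (v 1)]
  obtain ⟨ha, hb⟩ := abs_le.1 h2
  set r : unitInterval := ⟨(1 + v 2) / 2, by linarith, by linarith⟩ with hr
  have hs := Real.sq_sqrt (mul_nonneg r.2.1 (sub_nonneg.2 r.2.2))
  obtain ⟨z, hz1, hz2⟩ := Circle.exists_eq_mul (x := v 0) (y := v 1)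
    (r := 2 * √((r : ℝ) * (1 - r))) (by positivity) (by rw [mul_pow, hs, hr]; linarith)
  refine ⟨(z, r), Subtype.ext ?_⟩
  ext i
  fin_cases i
  · exact hz1
  · exact hz2
  · change 2 * ((1 + v 2) / 2) - 1 = v 2
    ring

theorem ofPolar_one (z : Circle) : ofPolar (z, 1) = base := by
  apply Subtype.ext
  ext i
  fin_cases i <;> simp [ofPolar, base]
  norm_num

theorem ofPolar_eq {z z' : Circle} {r r' : unitInterval} (h : ofPolar (z, r) = ofPolar (z', r')) :
    r = r' ∧ (z = z' ∨ r = 0 ∨ r = 1) := by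
  have h0 := congrFun (congrArg (fun u : Sphere2 => u.1.ofLp) h) 0
  have h1 := congrFun (congrArg (fun u : Sphere2 => u.1.ofLp) h) 1
  have h2 := congrFun (congrArg (fun u : Sphere2 => u.1.ofLp) h) 2
  simp only [ofPolar, Matrix.cons_val] at h0 h1 h2
  obtain rfl : r = r' := Subtype.ext (by linarith)
  refine ⟨rfl, ?_⟩
  by_cases hs : √((r : ℝ) * (1 - r)) = 0
  · rw [Real.sqrt_eq_zero (mul_nonneg r.2.1 (sub_nonneg.2 r.2.2)), mul_eq_zero] at hs
    rcases hs with hs | hs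
    · exact .inr (.inl (Subtype.ext hs))
    · exact .inr (.inr (Subtype.ext (sub_eq_zero.1 hs).symm))
  · left
    have hs' : 2 * √((r : ℝ) * (1 - r)) ≠ 0 := by simpa using hs
    exact Circle.ext (Complex.ext (mul_left_cancel₀ hs' h0) (mul_left_cancel₀ hs' h1))

theorem exists_lift {T : Type*} [TopologicalSpace T] (h : C(Circle × unitInterval, T)) (b : T)
    (h0 : ∀ z z', h (z, 0) = h (z', 0)) (h1 : ∀ z, h (z, 1) = b) :
    ∃ F : C(Sphere2, T), F base = b ∧ ∀ q, F (ofPolar q) = h q := by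
  let P : C(Circle × unitInterval, Sphere2) := ⟨ofPolar, continuous_ofPolar⟩
  have hP : IsQuotientMap P :=
    P.continuous.isClosedMap.isQuotientMap P.continuous surjective_ofPolar
  have hfac : Function.FactorsThrough h P := by
    rintro ⟨z, r⟩ ⟨z', r'⟩ hq
    obtain ⟨rfl, rfl | rfl | rfl⟩ := ofPolar_eq hq
    · rfl
    · exact h0 _ _
    · rw [h1, h1]
  have key : ∀ q, hP.lift h hfac (ofPolar q) = h q :=
    fun q => DFunLike.congr_fun (hP.lift_comp h hfac) q
  refine ⟨hP.lift h hfac, ?_, key⟩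
  rw [← ofPolar_one 1, key, h1]

end Sphere2

namespace Wedge

variable {X Z T : Type} {x : X} {z : Z}

/-- The inclusion of the second space in the wedge. -/
def inr (x : X) (z : Z) (a : Z) : Wedge X Z x z :=
  Quot.mk _ (Sum.inr a)

theorem inl_base : inl x z x = inr x z z := Quot.sound ⟨rfl, rfl⟩

theorem exists_eq (a : Wedge X Z x z) : (∃ b, inl x z b = a) ∨ ∃ b, inr x z b = a := by
  induction a using Quot.ind with
  | mk a => exact a.rec (fun b => .inl ⟨b, rfl⟩) (fun b => .inr ⟨b, rfl⟩)

variable [TopologicalSpace X] [TopologicalSpace Z] [TopologicalSpace T]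

theorem continuous_inl : Continuous (inl x z) := continuous_quot_mk.comp _root_.continuous_inl

theorem continuous_inr : Continuous (inr x z) := continuous_quot_mk.comp _root_.continuous_inr

/-- Two maps that agree at the base points, on the wedge. -/
def lift (f : C(X, T)) (g : C(Z, T)) (h : f x = g z) : C(Wedge X Z x z, T) where
  toFun := Quot.lift (Sum.elim f g) (by rintro _ _ ⟨rfl, rfl⟩; exact h)
  continuous_toFun := continuous_quot_lift _ (by fun_prop)

end Wedge

namespace SpheresWedgeProjectivePlane

/-- The inclusion of the projective plane. -/
noncomputable def plane : C(RealProjectivePlane, SpheresWedgeProjectivePlane) :=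
  ⟨Wedge.inr _ _, Wedge.continuous_inr⟩

/-- The inclusion of one of the two spheres. -/
noncomputable def sphere (i : Bool) : C(Sphere2, SpheresWedgeProjectivePlane) :=
  ⟨fun u => Wedge.inl _ _ (bif i then Wedge.inl _ _ u else Wedge.inr _ _ u), by
    refine Wedge.continuous_inl.comp ?_
    cases i
    · exact Wedge.continuous_inr
    · exact Wedge.continuous_inl⟩

theorem sphere_base (i : Bool) : sphere i Sphere2.base = plane RealProjectivePlane.base := by
  cases i
  · exact (congrArg (Wedge.inl _ _) Wedge.inl_base.symm).trans Wedge.inl_base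
  · exact Wedge.inl_base

/-- The two spheres as cones on circles. -/
noncomputable def cones : C((Bool × Circle) × unitInterval, SpheresWedgeProjectivePlane) :=
  ⟨fun q => sphere q.1.1 (Sphere2.ofPolar (q.1.2, q.2)), continuous_of_boolCircle fun i =>
    (sphere i).continuous.comp Sphere2.continuous_ofPolar⟩

/-- A sphere is the cone on a circle with its base collapsed to a point, so the wedge attaches two
cones along the constant map. -/
theorem isConeAttachment : IsConeAttachment (Prod.fst : Bool × Circle → Bool)
    (.const _ RealProjectivePlane.base) plane cones where
  apex := by
    rintro ⟨i, z⟩ ⟨_, z'⟩ rfl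
    refine congrArg (sphere i) (Subtype.ext ?_)
    simp [Sphere2.ofPolar]
  base a := by
    change sphere a.1 (Sphere2.ofPolar (a.2, 1)) = plane RealProjectivePlane.base
    rw [Sphere2.ofPolar_one, sphere_base]
  surj w := by
    rcases Wedge.exists_eq w with ⟨w, rfl⟩ | ⟨x, rfl⟩
    · right
      rcases Wedge.exists_eq w with ⟨u, rfl⟩ | ⟨u, rfl⟩
      · obtain ⟨q, rfl⟩ := Sphere2.surjective_ofPolar u
        exact ⟨((true, q.1), q.2), rfl⟩
      · obtain ⟨q, rfl⟩ := Sphere2.surjective_ofPolar u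
        exact ⟨((false, q.1), q.2), rfl⟩
    · exact .inl ⟨x, rfl⟩
  desc T _ f h h0 h1 := by
    have key : ∀ i, ∃ F : C(Sphere2, T), F Sphere2.base = f RealProjectivePlane.base ∧
        ∀ q, F (Sphere2.ofPolar q) = h ((i, q.1), q.2) := fun i =>
      Sphere2.exists_lift ⟨fun q => h ((i, q.1), q.2), by fun_prop⟩ _
        (fun z z' => h0 _ _ rfl) (fun z => h1 _)
    obtain ⟨F, hF, hF'⟩ := key true
    obtain ⟨G, hG, hG'⟩ := key false
    refine ⟨Wedge.lift (Wedge.lift F G (hF.trans hG.symm)) f hF, fun x => rfl, ?_⟩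
    rintro ⟨⟨i, z⟩, r⟩
    cases i
    · exact hG' (z, r)
    · exact hF' (z, r)

end SpheresWedgeProjectivePlane

namespace SL3
attribute [local instance] LieRing.ofAssociativeRing

/-! ### The `2`-skeleton as two discs attached to a projective plane -/

/-- The point of the `2`-skeleton with given Plücker coordinates. -/
def skeletonPoint (p : Fin 7 → ℝ) (hp : p ≠ 0 ∧ PluckerRel p ∧ p 0 = 0) : skeleton 2 :=
  ⟨toY ⟨p, hp.1, hp.2.1⟩, toY_mem_skeleton.2 hp.2.2⟩

theorem continuous_skeletonPoint {T : Type*} [TopologicalSpace T] {f : T → Fin 7 → ℝ}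
    (hf : Continuous f) (h : ∀ t, f t ≠ 0 ∧ PluckerRel (f t) ∧ f t 0 = 0) :
    Continuous fun t => skeletonPoint (f t) (h t) :=
  Continuous.subtype_mk (continuous_toY.comp (hf.subtype_mk fun t => ⟨(h t).1, (h t).2.1⟩)) _

theorem skeletonPoint_eq_iff {p q : Fin 7 → ℝ} (hp : p ≠ 0 ∧ PluckerRel p ∧ p 0 = 0)
    (hq : q ≠ 0 ∧ PluckerRel q ∧ q 0 = 0) :
    skeletonPoint p hp = skeletonPoint q hq ↔ ∃ c : ℝ, c ≠ 0 ∧ p = c • q := by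
  refine ⟨fun h => exists_smul_of_plane_eq hp.2.1 hp.1 hq.1 hq.2.1
    (congrArg (fun l : skeleton 2 => l.1.1) h), ?_⟩
  rintro ⟨c, hc, rfl⟩
  exact Subtype.ext (Subtype.ext (plane_smul hc q))

theorem exists_skeletonPoint (l : skeleton 2) : ∃ p hp, skeletonPoint p hp = l := by
  obtain ⟨l, hl⟩ := l
  obtain ⟨p, rfl⟩ := toY_surjective l
  exact ⟨p.1, ⟨p.2.1, p.2.2, toY_mem_skeleton.1 hl⟩, rfl⟩

theorem projVec_mem {v : Fin 3 → ℝ} (hv : v ≠ 0) : projVec (v 2) (v 0) (v 1) ≠ 0 ∧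
    PluckerRel (projVec (v 2) (v 0) (v 1)) ∧ projVec (v 2) (v 0) (v 1) 0 = 0 := by
  refine ⟨fun h => hv ?_, pluckerRel_projVec _ _ _, rfl⟩
  obtain ⟨h2, h0, h1⟩ := projVec_eq_zero.1 h
  ext i; fin_cases i <;> assumption

/-- The projective plane in the `2`-skeleton: the planes that contain `E₁₃`. -/
noncomputable def projPlane : C(RealProjectivePlane, skeleton 2) where
  toFun := Projectivization.lift
    (fun v : {v : Fin 3 → ℝ // v ≠ 0} => skeletonPoint _ (projVec_mem v.2)) (by
      rintro ⟨v, hv⟩ ⟨w, hw⟩ t (rfl : v = t • w)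
      rw [skeletonPoint_eq_iff]
      refine ⟨t, by rintro rfl; simp at hv, ?_⟩
      ext i; fin_cases i <;> simp [projVec])
  continuous_toFun := by
    refine Continuous.quotient_lift ?_ _
    refine continuous_skeletonPoint (continuous_projVec ?_ ?_ ?_) fun v => projVec_mem v.2 <;>
    exact (continuous_apply _).comp continuous_subtype_val

theorem projPlane_mk {v : Fin 3 → ℝ} (hv : v ≠ 0) :
    projPlane (RealProjectivePlane.mk v hv) = skeletonPoint _ (projVec_mem hv) := rfl

theorem injective_projPlane : Function.Injective projPlane := by
  intro a b hab
  obtain ⟨v, hv, rfl⟩ := RealProjectivePlane.exists_mk a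
  obtain ⟨w, hw, rfl⟩ := RealProjectivePlane.exists_mk b
  rw [projPlane_mk, projPlane_mk, skeletonPoint_eq_iff] at hab
  obtain ⟨c, -, hc⟩ := hab
  refine (RealProjectivePlane.mk_eq_mk_iff _ _).2 ⟨c, ?_⟩
  ext i
  fin_cases i
  · exact (congrFun hc 5).symm
  · exact (congrFun hc 6).symm
  · exact (congrFun hc 3).symm

/-- The Plücker coordinates of two discs, parametrized by `(x, y)` and the distance `s` to the
boundary. -/
def discVec (i : Bool) (s x y : ℝ) : Fin 7 → ℝ :=
  bif i then ![0, s ^ 2, 0, 0, s * y, x, -y ^ 2] else ![0, 0, s ^ 2, s * y, s * y, y ^ 2, x]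

theorem pluckerRel_discVec (i : Bool) (s x y : ℝ) : PluckerRel (discVec i s x y) := by
  cases i <;> constructor <;> simp [discVec] <;> ring

theorem discVec_mem (i : Bool) {s x y : ℝ} (h : s ≠ 0 ∨ x ≠ 0 ∨ y ≠ 0) :
    discVec i s x y ≠ 0 ∧ PluckerRel (discVec i s x y) ∧ discVec i s x y 0 = 0 := by
  refine ⟨fun h0 => ?_, pluckerRel_discVec i s x y, by cases i <;> rfl⟩
  cases i
  · have h2 : s ^ 2 = 0 := congrFun h0 2
    have h5 : y ^ 2 = 0 := congrFun h0 5
    have h6 : x = 0 := congrFun h0 6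
    simp_all
  · have h1 : s ^ 2 = 0 := congrFun h0 1
    have h6 : -y ^ 2 = 0 := congrFun h0 6
    have h5 : x = 0 := congrFun h0 5
    simp_all

/-- The boundaries of the two discs. -/
def boundaryVec (i : Bool) (x y : ℝ) : Fin 3 → ℝ :=
  bif i then ![x, -y ^ 2, 0] else ![y ^ 2, x, 0]

theorem boundaryVec_two (i : Bool) (x y : ℝ) : boundaryVec i x y 2 = 0 := by
  cases i <;> rfl

theorem boundaryVec_ne_zero (i : Bool) (z : Circle) :
    boundaryVec i (z : ℂ).re (z : ℂ).im ≠ 0 := by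
  intro h
  have h1 := Circle.re_sq_add_im_sq z
  cases i
  · have h2 : (z : ℂ).im ^ 2 = 0 := congrFun h 0
    have h3 : (z : ℂ).re = 0 := congrFun h 1
    rw [h2, h3] at h1; simp at h1
  · have h2 : -(z : ℂ).im ^ 2 = 0 := congrFun h 1
    have h3 : (z : ℂ).re = 0 := congrFun h 0
    rw [neg_eq_zero.1 h2, h3] at h1; simp at h1

theorem continuous_boundaryVec :
    Continuous fun a : Bool × Circle => boundaryVec a.1 (a.2 : ℂ).re (a.2 : ℂ).im := by
  have h1 := Circle.continuous_re
  have h2 := Circle.continuous_im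
  refine continuous_prod_of_discrete_left.2 fun i => continuous_pi fun j => ?_
  cases i <;> fin_cases j <;> simp [boundaryVec] <;> fun_prop

/-- The attaching maps of the two discs. -/
noncomputable def attachingMap : C(Bool × Circle, RealProjectivePlane) :=
  ⟨fun a => RealProjectivePlane.mk _ (boundaryVec_ne_zero a.1 a.2),
    RealProjectivePlane.continuous_mk continuous_boundaryVec _⟩

/-- The attaching maps come with lifts to nonzero vectors whose last coordinate is zero, so the
segment from such a vector to (0, 0, 1) avoids the origin and descends to a homotopy of lines. -/
theorem nonempty_attachingMap_homotopy : Nonempty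
    (attachingMap.Homotopy (.const _ RealProjectivePlane.base)) := by
  have hne : ∀ q : unitInterval × (Bool × Circle), (1 - (q.1 : ℝ)) •
      boundaryVec q.2.1 (q.2.2 : ℂ).re (q.2.2 : ℂ).im + (q.1 : ℝ) • Pi.single 2 1 ≠ 0 := by
    intro q h
    have h2 := congrFun h 2
    simp only [Pi.add_apply, Pi.smul_apply, boundaryVec_two, Pi.single_eq_same, smul_eq_mul,
      mul_zero, zero_add, mul_one, Pi.zero_apply] at h2
    rw [h2] at h
    simp only [sub_zero, one_smul, zero_smul, add_zero] at h
    exact boundaryVec_ne_zero _ _ h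
  refine ⟨⟨⟨fun q => RealProjectivePlane.mk _ (hne q), RealProjectivePlane.continuous_mk ?_ _⟩,
    fun a => ?_, fun a => ?_⟩⟩
  · have := continuous_boundaryVec
    exact ((continuous_const.sub (continuous_subtype_val.comp continuous_fst)).smul
      (this.comp continuous_snd)).add
      ((continuous_subtype_val.comp continuous_fst).smul continuous_const)
  · refine (RealProjectivePlane.mk_eq_mk_iff _ _).2 ⟨1, ?_⟩
    simp
  · refine (RealProjectivePlane.mk_eq_mk_iff _ _).2 ⟨1, ?_⟩
    simp

theorem polar_mem (i : Bool) (z : Circle) (r : ℝ) :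
    discVec i (1 - r) (r * (z : ℂ).re) (r * (z : ℂ).im) ≠ 0 ∧
    PluckerRel (discVec i (1 - r) (r * (z : ℂ).re) (r * (z : ℂ).im)) ∧
    discVec i (1 - r) (r * (z : ℂ).re) (r * (z : ℂ).im) 0 = 0 := by
  refine discVec_mem i ?_
  by_contra! h
  obtain ⟨h1, h2, h3⟩ := h
  have h4 := Circle.re_sq_add_im_sq z
  obtain rfl : r = 1 := by linarith
  rw [one_mul] at h2 h3
  rw [h2, h3] at h4
  simp at h4

/-- The two discs, as cones on their boundaries. -/
noncomputable def discs : C((Bool × Circle) × unitInterval, skeleton 2) :=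
  ⟨fun q => skeletonPoint _ (polar_mem q.1.1 q.1.2 q.2), continuous_of_boolCircle fun i => by
    refine continuous_skeletonPoint ?_ _
    have h1 := Circle.continuous_re
    have h2 := Circle.continuous_im
    refine continuous_pi fun j => ?_
    cases i <;> fin_cases j <;> simp [discVec] <;> fun_prop⟩

/-- Uniqueness of the parameters of a point in the interior of a disc. -/
theorem disc_unique {r r' x x' y y' c : ℝ} (hr0 : 0 ≤ r) (hr : r < 1) (hr0' : 0 ≤ r')
    (hr' : r' < 1) (h : x ^ 2 + y ^ 2 = r ^ 2) (h' : x' ^ 2 + y' ^ 2 = r' ^ 2)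
    (h1 : (1 - r) ^ 2 = c * (1 - r') ^ 2) (h2 : (1 - r) * y = c * ((1 - r') * y'))
    (h3 : x = c * x') : r = r' ∧ x = x' ∧ y = y' := by
  -- Scaling (s, x, y) with weights (1, 2, 1) multiplies the disc coordinates by a square; k is the
  -- scaling factor between the two parameters.
  set k := (1 - r) / (1 - r') with hk
  have hr1 : 0 < 1 - r := by linarith
  have hr1' : 0 < 1 - r' := by linarith
  have hkpos : 0 < k := div_pos hr1 hr1'
  have hk1 : 1 - r = k * (1 - r') := by rw [hk]; field_simp
  have hc : c = k ^ 2 := by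
    rw [hk1] at h1
    have : (1 - r') ^ 2 ≠ 0 := by positivity
    apply mul_right_cancel₀ this; linarith
  have hy : y = k * y' := by
    rw [hk1, hc] at h2
    apply mul_left_cancel₀ (mul_pos hkpos hr1').ne'; linarith
  have hx : x = k ^ 2 * x' := by rw [h3, hc]
  -- If k < 1, then x and y shrink and r ≤ r', whereas 1 - r < 1 - r'. The case k > 1 is symmetric.
  have hkone : k = 1 := by
    rcases lt_trichotomy k 1 with hlt | heq | hgt
    · have hle : r ^ 2 ≤ r' ^ 2 := by
        rw [← h, ← h', hx, hy, mul_pow, mul_pow, ← pow_mul]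
        have e1 : k ^ (2 * 2) ≤ 1 := pow_le_one₀ hkpos.le hlt.le
        have e2 : k ^ 2 ≤ 1 := pow_le_one₀ hkpos.le hlt.le
        nlinarith [sq_nonneg x', sq_nonneg y']
      have hle' : r ≤ r' := by nlinarith
      nlinarith
    · exact heq
    · have hle : r' ^ 2 ≤ r ^ 2 := by
        rw [← h, ← h', hx, hy, mul_pow, mul_pow, ← pow_mul]
        have e1 : 1 ≤ k ^ (2 * 2) := one_le_pow₀ hgt.le
        have e2 : 1 ≤ k ^ 2 := one_le_pow₀ hgt.le
        nlinarith [sq_nonneg x', sq_nonneg y']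
      have hle' : r' ≤ r := by nlinarith
      nlinarith
  rw [hkone] at hk1 hx hy
  exact ⟨by linarith, by linarith, by linarith⟩

/-- Existence of the parameters of a point in the interior of a disc. -/
theorem disc_exists (a b : ℝ) : ∃ r : unitInterval, ∃ z : Circle, (r : ℝ) < 1 ∧
    (r : ℝ) * (z : ℂ).re = (1 - r) ^ 2 * b ∧ (r : ℝ) * (z : ℂ).im = (1 - r) * a := by
  -- The condition that the two prescribed values have norm r is solved for r: the function is at
  -- most 0 at r = 0 and equals 1 at r = 1.
  have hivt := intermediate_value_Icc (zero_le_one' ℝ)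
    (f := fun r : ℝ => r ^ 2 - ((1 - r) ^ 2 * b) ^ 2 - ((1 - r) * a) ^ 2) (by fun_prop)
  obtain ⟨r, hr, h⟩ := hivt (show (0 : ℝ) ∈ Icc _ _ from ⟨by simp; nlinarith, by simp⟩)
  have h : r ^ 2 - ((1 - r) ^ 2 * b) ^ 2 - ((1 - r) * a) ^ 2 = 0 := h
  have hr1 : r ≠ 1 := by rintro rfl; simp at h
  obtain ⟨z, hz1, hz2⟩ := Circle.exists_eq_mul (x := (1 - r) ^ 2 * b) (y := (1 - r) * a) hr.1
    (by linarith)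
  exact ⟨⟨r, hr⟩, z, lt_of_le_of_ne hr.2 hr1, hz1, hz2⟩

/-- With s = 1 - r and (x, y) = r z, the interior r < 1 of a disc fills the cell p 1 ≠ 0 or p 2 ≠ 0,
with affine coordinates y / s and x / s². At r = 1 both coordinates p 1 and p 2 vanish and the disc
reaches the projective plane. -/
theorem isConeAttachment_skeleton : IsConeAttachment (Prod.fst : Bool × Circle → Bool)
    attachingMap projPlane discs := by
  have hbase : ∀ (a : Bool × Circle), discs (a, 1) = projPlane (attachingMap a) := by
    rintro ⟨i, z⟩
    refine (skeletonPoint_eq_iff (polar_mem i z (1 : unitInterval))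
      (projVec_mem (boundaryVec_ne_zero i z))).2 ⟨1, one_ne_zero, ?_⟩
    cases i <;> ext j <;> fin_cases j <;> simp [discVec, projVec, boundaryVec]
  have hinter : ∀ q x, discs q = projPlane x → q.2 = 1 := by
    rintro ⟨⟨i, z⟩, r⟩ x h
    obtain ⟨v, hv, rfl⟩ := RealProjectivePlane.exists_mk x
    obtain ⟨c, -, hc⟩ := (skeletonPoint_eq_iff (polar_mem i z r) (projVec_mem hv)).1 h
    have hr : (1 - (r : ℝ)) ^ 2 = 0 := by
      cases i
      · exact (congrFun hc 2).trans (mul_zero c)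
      · exact (congrFun hc 1).trans (mul_zero c)
    exact Subtype.ext (sub_eq_zero.1 (pow_eq_zero_iff two_ne_zero |>.1 hr)).symm
  refine IsConeAttachment.of_compact ?_ hbase ?_ injective_projPlane hinter ?_
  · rintro ⟨i, z⟩ ⟨_, z'⟩ rfl
    refine (skeletonPoint_eq_iff (polar_mem i z (0 : unitInterval))
      (polar_mem i z' (0 : unitInterval))).2 ⟨1, one_ne_zero, ?_⟩
    simp
  · intro l
    obtain ⟨p, hp, rfl⟩ := exists_skeletonPoint l
    obtain ⟨hp0, hrel, h0⟩ := hp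
    by_cases h1 : p 1 = 0
    swap
    · right
      obtain ⟨h2, h3, h6⟩ := hrel.eq_of_apply_one_ne_zero h0 h1
      obtain ⟨r, z, hr, hx, hy⟩ := disc_exists (p 4 / p 1) (p 5 / p 1)
      have hr' : (1 - (r : ℝ)) ≠ 0 := by linarith
      have h6' : p 6 = -p 4 ^ 2 / p 1 := by rw [← h6]; field_simp
      refine ⟨((true, z), r), (skeletonPoint_eq_iff (polar_mem true z r) _).2 ⟨(1 - (r : ℝ)) ^ 2 / p 1,
        div_ne_zero (pow_ne_zero _ hr') h1, ?_⟩⟩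
      ext j
      fin_cases j <;> simp [discVec, hx, hy, h0, h1, h2, h3, h6'] <;> field_simp
    by_cases h2 : p 2 = 0
    swap
    · right
      obtain ⟨h1, h3, h5⟩ := hrel.eq_of_apply_two_ne_zero h0 h2
      obtain ⟨r, z, hr, hx, hy⟩ := disc_exists (p 4 / p 2) (p 6 / p 2)
      have hr' : (1 - (r : ℝ)) ≠ 0 := by linarith
      have h5' : p 5 = p 4 ^ 2 / p 2 := by rw [← h5]; field_simp
      refine ⟨((false, z), r), (skeletonPoint_eq_iff (polar_mem false z r) _).2 ⟨(1 - (r : ℝ)) ^ 2 / p 2,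
        div_ne_zero (pow_ne_zero _ hr') h2, ?_⟩⟩
      ext j
      fin_cases j <;> simp [discVec, hx, hy, h0, h1, h2, h3, h5'] <;> field_simp
    · left
      have hp := hrel.eq_projVec h0 h1 h2
      have hv : ![p 5, p 6, p 3] ≠ 0 := by
        intro h
        apply hp0
        rw [hp, projVec_eq_zero]
        exact ⟨congrFun h 2, congrFun h 0, congrFun h 1⟩
      refine ⟨.mk _ hv, (skeletonPoint_eq_iff (projVec_mem hv) _).2 ⟨1, one_ne_zero, ?_⟩⟩
      rw [one_smul]
      exact hp.symm
  · rintro ⟨⟨i, z⟩, r⟩ ⟨⟨i', z'⟩, r'⟩ h hr1 hr1'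
    obtain ⟨c, -, hc⟩ :=
      (skeletonPoint_eq_iff (polar_mem i z r) (polar_mem i' z' r')).1 h
    have hr : (r : ℝ) < 1 := lt_of_le_of_ne r.2.2 fun h => hr1 (Subtype.ext h)
    have hr' : (r' : ℝ) < 1 := lt_of_le_of_ne r'.2.2 fun h => hr1' (Subtype.ext h)
    have hne : (1 - (r : ℝ)) ^ 2 ≠ 0 := pow_ne_zero _ (by linarith)
    -- Interior points of the two discs differ: exactly one of p 1 and p 2 is nonzero, and which one
    -- depends on the disc.
    obtain rfl : i = i' := by
      cases i <;> cases i' <;> try rfl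
      · exact absurd ((congrFun hc 2).trans (mul_zero c)) hne
      · exact absurd ((congrFun hc 1).trans (mul_zero c)) hne
    have key : (r : ℝ) = r' ∧ (r : ℝ) * (z : ℂ).re = r' * (z' : ℂ).re ∧
        (r : ℝ) * (z : ℂ).im = r' * (z' : ℂ).im := by
      refine disc_unique (c := c) r.2.1 hr r'.2.1 hr' ?_ ?_ ?_ ?_ ?_
      · linear_combination (r : ℝ) ^ 2 * Circle.re_sq_add_im_sq z
      · linear_combination (r' : ℝ) ^ 2 * Circle.re_sq_add_im_sq z'
      · cases i
        · exact congrFun hc 2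
        · exact congrFun hc 1
      · cases i
        · exact congrFun hc 4
        · exact congrFun hc 4
      · cases i
        · exact congrFun hc 6
        · exact congrFun hc 5
    obtain ⟨h1, h2, h3⟩ := key
    obtain rfl : r = r' := Subtype.ext h1
    by_cases h0 : (r : ℝ) = 0
    · exact .inr ⟨Subtype.ext h0, Subtype.ext h0, rfl⟩
    · left
      rw [Circle.ext (Complex.ext (mul_left_cancel₀ h0 h2) (mul_left_cancel₀ h0 h3))]

theorem nonempty_skeleton_homotopyEquiv :
    Nonempty (skeleton 2 ≃ₕ SpheresWedgeProjectivePlane) := by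
  obtain ⟨G⟩ := nonempty_attachingMap_homotopy
  exact isConeAttachment_skeleton.nonempty_homotopyEquiv
    SpheresWedgeProjectivePlane.isConeAttachment G

end SL3

theorem proposition5p11 :
    Nonempty (SL3.skeleton 2 ≃ₕ SpheresWedgeProjectivePlane) ∧
      PathConnectedSpace SL3.Y ∧
      (∀ l : SL3.Y, Nonempty (FundamentalGroup SL3.Y l ≃* Multiplicative (ZMod 2))) ∧
      (∀ l ∈ SL3.projLine, ∃ γ : Path l l, TraversesOnce γ SL3.projLine) ∧
      (∀ (l : SL3.Y) (γ : Path l l), TraversesOnce γ SL3.projLine →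
        Subgroup.zpowers (FundamentalGroup.fromPath (Path.Homotopic.Quotient.mk γ)) = ⊤) := by
  exact ⟨SL3.nonempty_skeleton_homotopyEquiv, inferInstance,
    SL3.nonempty_fundamentalGroup_mulEquiv, SL3.exists_traversesOnce,
    SL3.zpowers_eq_top_of_traversesOnce⟩
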